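/- Let $d\in\{2,3\}$, let $\Omega\subset\mathbb R^d$ be a bounded, open, connected, nonempty set, and let $\nu>0$. Write $(\cdot,\cdot)$ and $\|\cdot\|$ for the $L^2(\Omega)$ inner product and norm, $X=H^1_0(\Omega)^d$, $Q=\{q\in L^2(\Omega):\int_\Omega q\,dx=0\}$ and $V=\{v\in X:(\nabla\cdot v,q)=0\ \ \forall q\in Q\}$. Let $f\in X'=H^{-1}(\Omega)$, and write also $(f,\chi)$ for the value of $f$ at $\chi\in X$. For a functional $\ell$ on $V$ put $\|\ell\|_{V'}=\sup_{0\ne\chi\in V}\ell(\chi)/\|\nabla\chi\|$, and put $\|f\|_{-1}=\sup_{0\ne\chi\in X}(f,\chi)/\|\nabla\chi\|$. Let $M$ be a constant such that $$(v\cdot\nabla w,\chi)\le M\|\nabla v\|\,\|\nabla w\|\,\|\nabla\chi\|\qquad\forall v,w,\chi\in V,$$ that is, $M$ is at least the smallest nonnegative constant with this property, and set $\kappa=M\nu^{-2}\|f\|_{-1}$. The Picard operator $q:V\to V$ of the steady Navier–Stokes equations is defined by: $q(u)\in V$ is the solution of $$\nu(\nabla q(u),\nabla v)+(u\cdot\nabla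 q(u),v)=(f,v)\qquad\forall v\in V,$$ and the nonlinear residual $g:V\to V'$ by $(g(v),\chi)=\nu(\nabla v,\nabla\chi)+(v\cdot\nabla v,\chi)-(f,\chi)$ for all $\chi\in V$. Let $m>1$ and let $u_0,u_1,\dots\in V$ be produced by AAg with depth $m$: with $m_k=\min\{k,m\}$, for each step $k$ $$u_{k+1}=\sum_{i=0}^{m_k}\alpha^{(k)}_{k+1-i}\,q(u_{k-i}),$$ where the coefficients satisfy $\sum_{i=0}^{m_k}\alpha^{(k)}_{k+1-i}=1$ and minimize, among all real coefficients with sum $1$, the quantity $\big\|\sum_{i=0}^{m_k}\alpha^{(k)}_{k+1-i}\,g(q(u_{k-i}))\big\|_{V'}^2$. Put $$\theta_{k+1}=\frac{\big\|\sum_{i=0}^{m_k}\alpha^{(k)}_{k+1-i}g(q(u_{k-i}))\big\|_{V'}}{\|g(q(u_k))\|_{V'}},\qquad \gamma_{k+1}=\frac{\big\|\sum_{i=0}^{m_k}\alpha^{(k)}_{k+1-i}g(q(u_{k-i}))\big\|_{V'}}{\|g(u_k)\|_{V'}}$$ (a quotient with zero denominator is read as $0$), and let $\bar\alpha$ be a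 number with $|\alpha^{(k)}_{k+1-i}|\le\bar\alpha$ for $0\le i\le m_k$. If $\kappa<1$, then for every $k>m$ $$\|g(u_{k+1})\|_{V'}\le\min\{\theta_{k+1}\kappa,\gamma_{k+1}\}\,\|g(u_k)\|_{V'}+4M(m+1)m^3\,\bar\alpha^2\,\frac{\kappa^2}{\nu^2(1-\kappa)^2}\sum_{i=0}^m\|g(u_{k-i})\|_{V'}^2 ,$$ and for $1<k\le m$ the same inequality holds with $m$ replaced on the right-hand side by $\min\{m,k\}$. -/

import Mathlib

open MeasureTheory
open scoped ContDiff

namespace NSE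

noncomputable section

/-- Euclidean space `ℝ^d`. -/
abbrev Euc (d : ℕ) : Type := EuclideanSpace ℝ (Fin d)

/-- Vector fields in `L²(Ω; ℝ^d)`. -/
abbrev L2Vec {d : ℕ} (Ω : Set (Euc d)) : Type := Lp (Euc d) 2 (volume.restrict Ω)

/-- Pairs `(u, (G₁, …, G_d))` of square integrable fields, a Hilbert space with
`‖(u, G)‖² = ‖u‖² + ∑ i, ‖G i‖²`. The Sobolev spaces below are subspaces of it:
a Sobolev field `u` is represented by the pair `(u, (∂₁u, …, ∂_d u))`, so the inherited norm
is the norm of `H¹`. -/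
abbrev L2Pair {d : ℕ} (Ω : Set (Euc d)) : Type :=
  WithLp 2 (L2Vec Ω × PiLp 2 (fun _ : Fin d => L2Vec Ω))

/-- `φ` is a smooth function with compact support contained in `Ω`. -/
def IsTestFun {d : ℕ} {F : Type*} [NormedAddCommGroup F] [NormedSpace ℝ F]
    (Ω : Set (Euc d)) (φ : Euc d → F) : Prop :=
  ContDiff ℝ ∞ φ ∧ HasCompactSupport φ ∧ tsupport φ ⊆ Ω

/-- The `i`-th (classical) partial derivative. -/
def partialDeriv {d : ℕ} {F : Type*} [NormedAddCommGroup F] [NormedSpace ℝ F]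
    (i : Fin d) (φ : Euc d → F) (x : Euc d) : F :=
  fderiv ℝ φ x (EuclideanSpace.single i 1)

/-- `g` is the weak partial derivative `∂ᵢ u` on `Ω`. -/
def IsWeakPartial {d : ℕ} (Ω : Set (Euc d)) (i : Fin d) (u g : L2Vec Ω) : Prop :=
  ∀ φ : Euc d → ℝ, IsTestFun Ω φ →
    ∫ x in Ω, partialDeriv i φ x • u x = - ∫ x in Ω, φ x • g x

lemma IsTestFun.memLp {d : ℕ} {F : Type*} [NormedAddCommGroup F] [NormedSpace ℝ F]
    {Ω : Set (Euc d)} {φ : Euc d → F} (h : IsTestFun Ω φ) :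
    MemLp φ 2 (volume.restrict Ω) :=
  (h.1.continuous.memLp_of_hasCompactSupport h.2.1).restrict Ω

lemma IsTestFun.memLp_partialDeriv {d : ℕ} {F : Type*} [NormedAddCommGroup F] [NormedSpace ℝ F]
    {Ω : Set (Euc d)} {φ : Euc d → F} (h : IsTestFun Ω φ) (i : Fin d) :
    MemLp (partialDeriv i φ) 2 (volume.restrict Ω) := by
  have hc : Continuous (partialDeriv i φ) :=
    (h.1.continuous_fderiv (by simp)).clm_apply continuous_const
  have hs : HasCompactSupport (partialDeriv i φ) :=
    h.2.1.fderiv_apply (𝕜 := ℝ) (EuclideanSpace.single i 1)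
  exact (hc.memLp_of_hasCompactSupport hs).restrict Ω

lemma integrable_smul_L2 {d : ℕ} {Ω : Set (Euc d)} {ψ : Euc d → ℝ}
    (hψ : MemLp ψ 2 (volume.restrict Ω)) (u : L2Vec Ω) :
    Integrable (fun x => ψ x • u x) (volume.restrict Ω) :=
  memLp_one_iff_integrable.1 ((Lp.memLp u).smul hψ)

lemma integral_smul_add {d : ℕ} {Ω : Set (Euc d)} {ψ : Euc d → ℝ}
    (hψ : MemLp ψ 2 (volume.restrict Ω)) (u v : L2Vec Ω) :
    ∫ x in Ω, ψ x • (u + v : L2Vec Ω) x =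
      (∫ x in Ω, ψ x • u x) + ∫ x in Ω, ψ x • v x := by
  rw [← integral_add (integrable_smul_L2 hψ u) (integrable_smul_L2 hψ v)]
  refine integral_congr_ae ?_
  filter_upwards [Lp.coeFn_add u v] with x hx
  rw [hx, Pi.add_apply, smul_add]

lemma integral_smul_smul {d : ℕ} {Ω : Set (Euc d)} (ψ : Euc d → ℝ) (c : ℝ) (u : L2Vec Ω) :
    ∫ x in Ω, ψ x • (c • u : L2Vec Ω) x = c • ∫ x in Ω, ψ x • u x := by
  rw [← integral_smul]
  refine integral_congr_ae ?_
  filter_upwards [Lp.coeFn_smul c u] with x hx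
  rw [hx, Pi.smul_apply, smul_comm]

lemma integral_smul_zero {d : ℕ} {Ω : Set (Euc d)} (ψ : Euc d → ℝ) :
    ∫ x in Ω, ψ x • (0 : L2Vec Ω) x = 0 := by
  have := integral_smul_smul ψ 0 (0 : L2Vec Ω)
  simpa using this

/-- The Sobolev space `H¹(Ω; ℝ^d)`, as the space of pairs `(u, ∇u)` with the weak gradient. -/
def H1 {d : ℕ} (Ω : Set (Euc d)) : Submodule ℝ (L2Pair Ω) where
  carrier := {p | ∀ i, IsWeakPartial Ω i p.fst (p.snd i)}
  zero_mem' := by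
    intro i φ _
    simp only [WithLp.zero_fst, WithLp.zero_snd, PiLp.zero_apply]
    rw [integral_smul_zero, integral_smul_zero, neg_zero]
  add_mem' := by
    intro p q hp hq i φ hφ
    simp only [WithLp.add_fst, WithLp.add_snd, PiLp.add_apply]
    rw [integral_smul_add (hφ.memLp_partialDeriv i), integral_smul_add hφ.memLp,
      hp i φ hφ, hq i φ hφ, neg_add]
  smul_mem' := by
    intro c p hp i φ hφ
    simp only [WithLp.smul_fst, WithLp.smul_snd, PiLp.smul_apply]
    rw [integral_smul_smul, integral_smul_smul, hp i φ hφ, smul_neg]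

/-- The pairs `(φ, ∇φ)` with `φ ∈ C_c^∞(Ω; ℝ^d)`. -/
def testFields {d : ℕ} (Ω : Set (Euc d)) : Submodule ℝ (L2Pair Ω) where
  carrier := {p | ∃ φ : Euc d → Euc d, IsTestFun Ω φ ∧
    (p.fst : Euc d → Euc d) =ᵐ[volume.restrict Ω] φ ∧
    ∀ i, (p.snd i : Euc d → Euc d) =ᵐ[volume.restrict Ω] partialDeriv i φ}
  zero_mem' := by
    refine ⟨fun _ => 0, ⟨contDiff_const, HasCompactSupport.zero, ?_⟩, ?_, fun i => ?_⟩
    · simp [tsupport]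
    · exact Lp.coeFn_zero _ _ _
    · refine (Lp.coeFn_zero _ _ _).trans (Filter.Eventually.of_forall fun x => ?_)
      simp [partialDeriv]
  add_mem' := by
    rintro p q ⟨φ, hφ, hp, hp'⟩ ⟨ψ, hψ, hq, hq'⟩
    refine ⟨φ + ψ, ⟨hφ.1.add hψ.1, hφ.2.1.add hψ.2.1,
      (tsupport_add φ ψ).trans (Set.union_subset hφ.2.2 hψ.2.2)⟩, ?_, fun i => ?_⟩
    · exact (Lp.coeFn_add _ _).trans (hp.add hq)
    · refine (Lp.coeFn_add _ _).trans (((hp' i).add (hq' i)).trans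
        (Filter.Eventually.of_forall fun x => ?_))
      have h1 : DifferentiableAt ℝ φ x := (hφ.1.differentiable (by simp)) x
      have h2 : DifferentiableAt ℝ ψ x := (hψ.1.differentiable (by simp)) x
      simp [partialDeriv, fderiv_add h1 h2]
  smul_mem' := by
    rintro c p ⟨φ, hφ, hp, hp'⟩
    refine ⟨c • φ, ⟨hφ.1.const_smul c, hφ.2.1.comp_left (g := fun y => c • y) (smul_zero c),
      (closure_mono (Function.support_const_smul_subset c φ)).trans hφ.2.2⟩, ?_, fun i => ?_⟩
    · exact (Lp.coeFn_smul _ _).trans (hp.const_smul c)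
    · refine (Lp.coeFn_smul _ _).trans (((hp' i).const_smul c).trans
        (Filter.Eventually.of_forall fun x => ?_))
      have h1 : DifferentiableAt ℝ φ x := (hφ.1.differentiable (by simp)) x
      simp [partialDeriv, fderiv_const_smul h1]

/-- The velocity space `X = H¹₀(Ω; ℝ^d)`: the `H¹` fields that vanish on `∂Ω`, i.e. those in the
`H¹`-closure of the test fields. -/
def X {d : ℕ} (Ω : Set (Euc d)) : Submodule ℝ (L2Pair Ω) :=
  H1 Ω ⊓ (testFields Ω).topologicalClosure

/-- The pressure space `Q = L²₀(Ω)`. -/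
def Q {d : ℕ} (Ω : Set (Euc d)) : Set (Lp ℝ 2 (volume.restrict Ω)) :=
  {q | ∫ x in Ω, q x = 0}

/-- The divergence `∇ · u = ∑ i, (∂ᵢ u)ᵢ`. -/
def divergence {d : ℕ} {Ω : Set (Euc d)} (p : L2Pair Ω) (x : Euc d) : ℝ :=
  ∑ i, p.snd i x i

lemma memLp_divergence {d : ℕ} {Ω : Set (Euc d)} (p : L2Pair Ω) :
    MemLp (divergence p) 2 (volume.restrict Ω) := by
  refine memLp_finsetSum (μ := volume.restrict Ω) Finset.univ
    (f := fun i x => p.snd i x i) fun i _ => ?_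
  exact (EuclideanSpace.proj i : Euc d →L[ℝ] ℝ).comp_memLp'
    (Lp.memLp (p.snd i))

lemma integrable_divergence_mul {d : ℕ} {Ω : Set (Euc d)} (p : L2Pair Ω)
    (q : Lp ℝ 2 (volume.restrict Ω)) :
    Integrable (fun x => divergence p x * q x) (volume.restrict Ω) :=
  (memLp_divergence p).integrable_mul (Lp.memLp q)

lemma divergence_add {d : ℕ} {Ω : Set (Euc d)} (p q : L2Pair Ω) :
    ∀ᵐ x ∂(volume.restrict Ω), divergence (p + q) x = divergence p x + divergence q x := by
  have hall : ∀ᵐ x ∂(volume.restrict Ω), ∀ i,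
      (p.snd i + q.snd i : L2Vec Ω) x = p.snd i x + q.snd i x :=
    ae_all_iff.2 fun i => Lp.coeFn_add _ _
  filter_upwards [hall] with x hx
  unfold divergence
  rw [← Finset.sum_add_distrib]
  refine Finset.sum_congr rfl fun i _ => ?_
  exact congrArg (fun y : Euc d => y i) (hx i)

lemma divergence_smul {d : ℕ} {Ω : Set (Euc d)} (c : ℝ) (p : L2Pair Ω) :
    ∀ᵐ x ∂(volume.restrict Ω), divergence (c • p) x = c * divergence p x := by
  have hall : ∀ᵐ x ∂(volume.restrict Ω), ∀ i,
      (c • p.snd i : L2Vec Ω) x = c • p.snd i x :=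
    ae_all_iff.2 fun i => Lp.coeFn_smul _ _
  filter_upwards [hall] with x hx
  unfold divergence
  rw [Finset.mul_sum]
  refine Finset.sum_congr rfl fun i _ => ?_
  exact congrArg (fun y : Euc d => y i) (hx i)

/-- The divergence-free velocity space `V = {v ∈ X : (∇ · v, q) = 0 for all q ∈ Q}`. -/
def V {d : ℕ} (Ω : Set (Euc d)) : Submodule ℝ (X Ω) where
  carrier := {v | ∀ q ∈ Q Ω, ∫ x in Ω, divergence (v : L2Pair Ω) x * q x = 0}
  zero_mem' := by
    intro q _
    rw [← integral_zero (Euc d) ℝ (μ := volume.restrict Ω)]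
    refine integral_congr_ae ?_
    filter_upwards [divergence_smul (0 : ℝ) (0 : L2Pair Ω)] with x hx
    rw [zero_smul, zero_mul] at hx
    rw [ZeroMemClass.coe_zero, hx, zero_mul]
  add_mem' := by
    intro v w hv hw q hq
    have h : ∫ x in Ω, divergence ((v + w : X Ω) : L2Pair Ω) x * q x =
        ∫ x in Ω, (divergence (v : L2Pair Ω) x * q x + divergence (w : L2Pair Ω) x * q x) := by
      refine integral_congr_ae ?_
      filter_upwards [divergence_add (v : L2Pair Ω) w] with x hx
      rw [Submodule.coe_add, hx, add_mul]
    rw [h, integral_add (integrable_divergence_mul _ q) (integrable_divergence_mul _ q),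
      hv q hq, hw q hq, add_zero]
  smul_mem' := by
    intro c v hv q hq
    have h : ∫ x in Ω, divergence ((c • v : X Ω) : L2Pair Ω) x * q x =
        ∫ x in Ω, c * (divergence (v : L2Pair Ω) x * q x) := by
      refine integral_congr_ae ?_
      filter_upwards [divergence_smul c (v : L2Pair Ω)] with x hx
      rw [Submodule.coe_smul, hx, mul_assoc]
    rw [h, integral_const_mul, hv q hq, mul_zero]

/-- `(∇u, ∇v)`, the `L²(Ω)` inner product of the gradients. -/
def gradInner {d : ℕ} {Ω : Set (Euc d)} (u v : L2Pair Ω) : ℝ := inner ℝ u.snd v.snd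

/-- `‖∇u‖`, the `L²(Ω)` norm of the gradient. -/
def gradNorm {d : ℕ} {Ω : Set (Euc d)} (u : L2Pair Ω) : ℝ := ‖u.snd‖

/-- `(u · ∇v, w) = ∫_Ω ∑ i, uᵢ (∂ᵢ v · w)`. -/
def convection {d : ℕ} {Ω : Set (Euc d)} (u v w : L2Pair Ω) : ℝ :=
  ∫ x in Ω, ∑ i, u.fst x i * inner ℝ (v.snd i x) (w.fst x)

/-- The norm `sup_{χ ≠ 0} ℓ(χ) / N(χ)` of a functional `ℓ`, dual to the norm `N`. -/
def dualNorm {Y : Type*} [Zero Y] (N ℓ : Y → ℝ) : ℝ :=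
  sSup {r | ∃ χ : Y, χ ≠ 0 ∧ r = ℓ χ / N χ}

/-- The norm of `V'`: `‖ℓ‖_{V'} = sup_{0 ≠ χ ∈ V} ℓ(χ) / ‖∇χ‖`. -/
def normV' {d : ℕ} {Ω : Set (Euc d)} (ℓ : V Ω → ℝ) : ℝ :=
  dualNorm (fun χ : V Ω => gradNorm (χ : L2Pair Ω)) ℓ

/-- The norm of `X' = H⁻¹(Ω)`: `‖f‖₋₁ = sup_{0 ≠ χ ∈ X} f(χ) / ‖∇χ‖`. -/
def normX' {d : ℕ} {Ω : Set (Euc d)} (f : X Ω →L[ℝ] ℝ) : ℝ :=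
  dualNorm (fun χ : X Ω => gradNorm (χ : L2Pair Ω)) f

/-- The smallest constant `C` with `(v · ∇w, χ) ≤ C ‖∇v‖ ‖∇w‖ ‖∇χ‖` for all `v, w, χ ∈ V`. -/
def convectionConst {d : ℕ} (Ω : Set (Euc d)) : ℝ :=
  sInf {C | 0 ≤ C ∧ ∀ v w χ : V Ω, convection (v : L2Pair Ω) w χ ≤
    C * gradNorm (v : L2Pair Ω) * gradNorm (w : L2Pair Ω) * gradNorm (χ : L2Pair Ω)}

/-- `κ = M ν⁻² ‖f‖₋₁`. -/
def kappa {d : ℕ} {Ω : Set (Euc d)} (M ν : ℝ) (f : X Ω →L[ℝ] ℝ) : ℝ :=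
  M * ν⁻¹ ^ 2 * normX' f

/-- `w = q(u)`: the weak form of the Picard linearization at `u`,
`ν(∇w, ∇v) + (u · ∇w, v) = (f, v)` for all `v ∈ V`. -/
def IsPicardSol {d : ℕ} {Ω : Set (Euc d)} (ν : ℝ) (f : X Ω →L[ℝ] ℝ) (u w : V Ω) : Prop :=
  ∀ v : V Ω, ν * gradInner (w : L2Pair Ω) v + convection (u : L2Pair Ω) w v = f v

/-- The Picard solution operator `q : V → V`. -/
def picard {d : ℕ} {Ω : Set (Euc d)} (ν : ℝ) (f : X Ω →L[ℝ] ℝ) (u : V Ω) : V Ω :=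
  Classical.epsilon (IsPicardSol ν f u)

/-- The nonlinear residual `g : V → V'`,
`(g(v), χ) = ν(∇v, ∇χ) + (v · ∇v, χ) - (f, χ)`. -/
def residual {d : ℕ} {Ω : Set (Euc d)} (ν : ℝ) (f : X Ω →L[ℝ] ℝ) (v : V Ω) : V Ω → ℝ :=
  fun χ => ν * gradInner (v : L2Pair Ω) χ + convection (v : L2Pair Ω) v χ - f χ

/-- The combination `∑_{i=0}^{n} a_i g(q(u_{k-i}))` in `V'`. -/
def combinedResidual {d : ℕ} {Ω : Set (Euc d)} (ν : ℝ) (f : X Ω →L[ℝ] ℝ) (u : ℕ → V Ω)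
    (k n : ℕ) (a : ℕ → ℝ) : V Ω → ℝ :=
  ∑ i ∈ Finset.range (n + 1), a i • residual ν f (picard ν f (u (k - i)))

/-- Step `k` of AAg with depth `m`, with `m_k = min k m`. The number `a i` is the coefficient
`α_{k+1-i}^{(k)}` of `q(u_{k-i})`, for `i = 0, …, m_k`. -/
structure IsAAgStep {d : ℕ} {Ω : Set (Euc d)} (ν : ℝ) (f : X Ω →L[ℝ] ℝ) (m : ℕ)
    (u : ℕ → V Ω) (k : ℕ) (a : ℕ → ℝ) : Prop where
  sum_eq_one : ∑ i ∈ Finset.range (min k m + 1), a i = 1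
  optimal : ∀ b : ℕ → ℝ, ∑ i ∈ Finset.range (min k m + 1), b i = 1 →
    normV' (combinedResidual ν f u k (min k m) a) ^ 2 ≤
      normV' (combinedResidual ν f u k (min k m) b) ^ 2
  update : u (k + 1) = ∑ i ∈ Finset.range (min k m + 1), a i • picard ν f (u (k - i))

/-- The optimization gain `θ_{k+1}`. -/
def theta {d : ℕ} {Ω : Set (Euc d)} (ν : ℝ) (f : X Ω →L[ℝ] ℝ) (m : ℕ)
    (u : ℕ → V Ω) (k : ℕ) (a : ℕ → ℝ) : ℝ :=
  normV' (combinedResidual ν f u k (min k m) a) / normV' (residual ν f (picard ν f (u k)))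

/-- The linear rate estimate `γ_{k+1}`. -/
def gamma {d : ℕ} {Ω : Set (Euc d)} (ν : ℝ) (f : X Ω →L[ℝ] ℝ) (m : ℕ)
    (u : ℕ → V Ω) (k : ℕ) (a : ℕ → ℝ) : ℝ :=
  normV' (combinedResidual ν f u k (min k m) a) / normV' (residual ν f (u k))

end

end NSE

/-!
The proof separates an algebraic part from the analysis of the spaces.

Algebra. Let `b` be a trilinear form with `b(u, v, v) = 0` and `|b(u, v, w)| ≤ M ‖∇u‖ ‖∇v‖ ‖∇w‖`
(`FlowData`), and let `wᵢ = q(uᵢ)`. Testing the Picard equation with its solution gives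
`ν ‖∇w‖ ≤ ‖f‖₋₁`, so `M ‖∇w‖ ≤ κ ν`. From `g(w) = b(w - u, w, ·)` and
`ν ‖∇(u - w)‖ ≤ ‖g(u)‖` it follows that `‖g(q(u))‖ ≤ κ ‖g(u)‖` (`IsSol.dnorm_res_le`), and `q` is
`κ`-Lipschitz. For `κ < 1` the Lipschitz bound can be absorbed, and
`‖∇(wᵢ - wⱼ)‖ ≤ κ / (ν (1 - κ)) (‖g(uᵢ)‖ + ‖g(uⱼ)‖)` (`IsSol.norm_sub_le_res`). As the `αᵢ` sum to
one, `g(∑ αᵢ wᵢ)` differs from `∑ αᵢ g(wᵢ)` only by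
`½ ∑ᵢⱼ αᵢ αⱼ b(wᵢ - wⱼ, wᵢ - wⱼ, ·)` (`FlowData.res_sum`), which yields the quadratic term of the
estimate. The linear term is the definition of `θ` and `γ` together with `‖g(q(u))‖ ≤ κ ‖g(u)‖`;
minimality of the coefficients is needed only when a denominator vanishes.

Analysis. The Gagliardo–Nirenberg–Sobolev inequality on test fields passes to their closure by lower
semicontinuity of the `L⁴` norm (`exists_eLpNorm_four_le`); it makes the convective form bounded in
the gradient norm and contains the Poincaré inequality. A field in `V` has divergence zero almost
everywhere, since its divergence has mean zero and is an admissible pressure; hence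
`(v · ∇φ, φ) = -½ ∫ (∇ · v) |φ|² = 0` for test fields `φ`, and by density for all `φ` in the closure
(`convection_self_eq_zero`). The Picard problem is then coercive on the closed subspace `V`, and the
Lax–Milgram theorem shows that `picard` is a genuine solution (`isPicardSol_picard`).
-/

namespace NSE

/-! ### Dual norms -/

section DualNorm

variable {Y H : Type*} [AddCommGroup Y] [Module ℝ Y] [NormedAddCommGroup H] [InnerProductSpace ℝ H]

/-- `ℓ` is bounded with respect to the seminorm `‖D ·‖`; the supremum in `dualNorm` is then a
genuine one. -/
def IsDualBounded (D : Y →ₗ[ℝ] H) (ℓ : Y →ₗ[ℝ] ℝ) : Prop :=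
  ∃ C : ℝ, ∀ χ, |ℓ χ| ≤ C * ‖D χ‖

theorem IsDualBounded.sum_smul {D : Y →ₗ[ℝ] H} {ι : Type*} (s : Finset ι) (a : ι → ℝ)
    {ℓ : ι → Y →ₗ[ℝ] ℝ} (h : ∀ i, IsDualBounded D (ℓ i)) :
    IsDualBounded D (∑ i ∈ s, a i • ℓ i) := by
  choose C hC using h
  refine ⟨∑ i ∈ s, |a i| * C i, fun χ => ?_⟩
  rw [LinearMap.sum_apply, Finset.sum_mul]
  refine (Finset.abs_sum_le_sum_abs _ _).trans (Finset.sum_le_sum fun i _ => ?_)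
  rw [LinearMap.smul_apply, smul_eq_mul, abs_mul, mul_assoc]
  exact mul_le_mul_of_nonneg_left (hC i χ) (abs_nonneg _)

theorem le_dualNorm_mul {D : Y →ₗ[ℝ] H} (hD : Function.Injective D) {ℓ : Y →ₗ[ℝ] ℝ}
    (h : IsDualBounded D ℓ) (χ : Y) : ℓ χ ≤ dualNorm (fun χ => ‖D χ‖) ℓ * ‖D χ‖ := by
  obtain ⟨C, hC⟩ := h
  by_cases h0 : χ = 0
  · simp [h0]
  have hpos : ∀ ψ : Y, ψ ≠ 0 → 0 < ‖D ψ‖ := fun ψ hψ =>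
    norm_pos_iff.2 fun h => hψ (hD (h.trans (map_zero D).symm))
  rw [← div_le_iff₀ (hpos χ h0)]
  refine le_csSup ⟨C, ?_⟩ ⟨χ, h0, rfl⟩
  rintro r ⟨ψ, hψ, rfl⟩
  rw [div_le_iff₀ (hpos ψ hψ)]
  exact (le_abs_self _).trans (hC ψ)

theorem dualNorm_nonneg {D : Y →ₗ[ℝ] H} (hD : Function.Injective D) {ℓ : Y →ₗ[ℝ] ℝ}
    (h : IsDualBounded D ℓ) : 0 ≤ dualNorm (fun χ => ‖D χ‖) ℓ := by
  by_cases hY : ∃ χ : Y, χ ≠ 0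
  · obtain ⟨χ, hχ⟩ := hY
    have hpos : 0 < ‖D χ‖ := norm_pos_iff.2 fun h => hχ (hD (h.trans (map_zero D).symm))
    have h1 := le_dualNorm_mul hD h χ
    have h2 := le_dualNorm_mul hD h (-χ)
    rw [map_neg, map_neg, norm_neg] at h2
    by_contra hneg
    nlinarith [mul_pos (neg_pos.2 (not_le.1 hneg)) hpos]
  · push Not at hY
    refine Real.sSup_nonneg ?_
    rintro r ⟨χ, hχ, -⟩
    exact absurd (hY χ) hχ

theorem dualNorm_le {D : Y →ₗ[ℝ] H} {ℓ : Y → ℝ} {C : ℝ} (hC : 0 ≤ C)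
    (h : ∀ χ, ℓ χ ≤ C * ‖D χ‖) : dualNorm (fun χ => ‖D χ‖) ℓ ≤ C := by
  refine Real.sSup_le ?_ hC
  rintro r ⟨χ, -, rfl⟩
  exact div_le_of_le_mul₀ (norm_nonneg _) hC (h χ)

end DualNorm

/-! ### Picard iteration and residuals for a skew-symmetric trilinear form -/

/-- The abstract form of the steady Navier–Stokes equations: the gradient `D`, the convective form
`b`, the load `F`, the viscosity `ν`, and constants `M`, `K` bounding `b` and `F` in the gradient
norm. -/
structure FlowData (Y H : Type*) [AddCommGroup Y] [Module ℝ Y] [NormedAddCommGroup H]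
    [InnerProductSpace ℝ H] where
  D : Y →ₗ[ℝ] H
  b : Y →ₗ[ℝ] Y →ₗ[ℝ] Y →ₗ[ℝ] ℝ
  F : Y →ₗ[ℝ] ℝ
  ν : ℝ
  M : ℝ
  K : ℝ
  injective : Function.Injective D
  ν_pos : 0 < ν
  M_nonneg : 0 ≤ M
  K_nonneg : 0 ≤ K
  skew : ∀ u v, b u v v = 0
  b_le : ∀ u v w, b u v w ≤ M * ‖D u‖ * ‖D v‖ * ‖D w‖
  F_le : ∀ v, F v ≤ K * ‖D v‖

namespace FlowData

variable {Y H : Type*} [AddCommGroup Y] [Module ℝ Y] [NormedAddCommGroup H] [InnerProductSpace ℝ H]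
  (S : FlowData Y H)

/-- The small-data constant `κ = M ν⁻² K`. -/
noncomputable def kap : ℝ := S.M * S.ν⁻¹ ^ 2 * S.K

/-- The norm of `V'`, dual to the gradient norm. -/
noncomputable def dnorm (ℓ : Y →ₗ[ℝ] ℝ) : ℝ := dualNorm (fun χ => ‖S.D χ‖) ℓ

/-- The nonlinear residual. -/
noncomputable def res (v : Y) : Y →ₗ[ℝ] ℝ :=
  S.ν • (innerₗ H (S.D v)).comp S.D + S.b v v - S.F

/-- `w` solves the Picard linearization at `u`. -/
def IsSol (u w : Y) : Prop := ∀ v, S.ν * inner ℝ (S.D w) (S.D v) + S.b u w v = S.F v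

theorem res_apply (v χ : Y) :
    S.res v χ = S.ν * inner ℝ (S.D v) (S.D χ) + S.b v v χ - S.F χ := by
  simp [res]

theorem kap_nonneg : 0 ≤ S.kap := by
  have := S.M_nonneg; have := S.K_nonneg
  unfold kap; positivity

theorem abs_b_le (u v w : Y) : |S.b u v w| ≤ S.M * ‖S.D u‖ * ‖S.D v‖ * ‖S.D w‖ := by
  refine abs_le.2 ⟨?_, S.b_le u v w⟩
  have := S.b_le u v (-w)
  rw [map_neg, map_neg, norm_neg] at this
  linarith

theorem isDualBounded_res (v : Y) : IsDualBounded S.D (S.res v) := by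
  refine ⟨S.ν * ‖S.D v‖ + S.M * ‖S.D v‖ * ‖S.D v‖ + S.K, fun χ => ?_⟩
  have hF : |S.F χ| ≤ S.K * ‖S.D χ‖ := by
    refine abs_le.2 ⟨?_, S.F_le χ⟩
    have := S.F_le (-χ)
    rw [map_neg, map_neg, norm_neg] at this
    linarith
  have hi : |S.ν * inner ℝ (S.D v) (S.D χ)| ≤ S.ν * (‖S.D v‖ * ‖S.D χ‖) := by
    rw [abs_mul, abs_of_pos S.ν_pos]
    exact mul_le_mul_of_nonneg_left (abs_real_inner_le_norm _ _) S.ν_pos.le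
  rw [res_apply]
  calc _ ≤ |S.ν * inner ℝ (S.D v) (S.D χ)| + |S.b v v χ| + |S.F χ| :=
        (abs_sub _ _).trans (add_le_add (abs_add_le _ _) le_rfl)
    _ ≤ _ := add_le_add (add_le_add hi (S.abs_b_le v v χ)) hF
    _ = _ := by ring

theorem dnorm_res_nonneg (v : Y) : 0 ≤ S.dnorm (S.res v) :=
  dualNorm_nonneg S.injective (S.isDualBounded_res v)

variable {S}

/-- The a priori bound for the Picard operator, by testing with the solution itself. -/
theorem IsSol.norm_le {u w : Y} (h : S.IsSol u w) : S.ν * ‖S.D w‖ ≤ S.K := by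
  have h1 := h w
  rw [S.skew, add_zero, real_inner_self_eq_norm_sq] at h1
  have h2 := S.F_le w
  rcases (norm_nonneg (S.D w)).eq_or_lt with h0 | h0
  · rw [← h0, mul_zero]; exact S.K_nonneg
  · refine le_of_mul_le_mul_right ?_ h0
    nlinarith

/-- The a priori bound in terms of `κ`. -/
theorem IsSol.mul_norm_le {u w : Y} (h : S.IsSol u w) : S.M * ‖S.D w‖ ≤ S.kap * S.ν := by
  have h1 : ‖S.D w‖ ≤ S.ν⁻¹ * S.K := by
    rw [← div_eq_inv_mul, le_div_iff₀' S.ν_pos]; exact h.norm_le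
  calc _ ≤ S.M * (S.ν⁻¹ * S.K) := mul_le_mul_of_nonneg_left h1 S.M_nonneg
    _ = _ := by have := S.ν_pos; unfold kap; field_simp

/-- The residual at the Picard update `w = q(u)` is `b(w - u, w, ·)`. -/
theorem IsSol.res_apply {u w : Y} (h : S.IsSol u w) (χ : Y) :
    S.res w χ = S.b (w - u) w χ := by
  rw [S.res_apply, ← h χ]
  simp only [map_sub, LinearMap.sub_apply]
  ring

/-- The residual at `u` controls the Picard update, by testing with `u - q(u)`. -/
theorem IsSol.norm_sub_le {u w : Y} (h : S.IsSol u w) :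
    S.ν * ‖S.D (u - w)‖ ≤ S.dnorm (S.res u) := by
  have h1 := le_dualNorm_mul S.injective (S.isDualBounded_res u) (u - w)
  have h2 : S.res u (u - w) = S.ν * ‖S.D (u - w)‖ ^ 2 := by
    have h3 := S.skew u (u - w)
    rw [map_sub (S.b u), LinearMap.sub_apply] at h3
    have e : ‖S.D (u - w)‖ ^ 2 =
        inner ℝ (S.D u) (S.D (u - w)) - inner ℝ (S.D w) (S.D (u - w)) := by
      rw [← inner_sub_left, ← map_sub, real_inner_self_eq_norm_sq]
    rw [S.res_apply, ← h (u - w), e]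
    linarith
  rw [h2] at h1
  rcases (norm_nonneg (S.D (u - w))).eq_or_lt with h0 | h0
  · rw [← h0, mul_zero]; exact S.dnorm_res_nonneg u
  · refine le_of_mul_le_mul_right ?_ h0
    unfold dnorm
    nlinarith

/-- One Picard step contracts the residual by the factor `κ`. -/
theorem IsSol.dnorm_res_le {u w : Y} (h : S.IsSol u w) :
    S.dnorm (S.res w) ≤ S.kap * S.dnorm (S.res u) := by
  refine dualNorm_le (mul_nonneg S.kap_nonneg (S.dnorm_res_nonneg u)) fun χ => ?_
  rw [h.res_apply]
  calc _ ≤ S.M * ‖S.D (w - u)‖ * ‖S.D w‖ * ‖S.D χ‖ := S.b_le _ _ _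
    _ = (S.M * ‖S.D w‖) * ‖S.D (u - w)‖ * ‖S.D χ‖ := by
        rw [← neg_sub u w, map_neg, norm_neg]; ring
    _ ≤ (S.kap * S.ν) * ‖S.D (u - w)‖ * ‖S.D χ‖ :=
        mul_le_mul_of_nonneg_right
          (mul_le_mul_of_nonneg_right h.mul_norm_le (norm_nonneg _)) (norm_nonneg _)
    _ = S.kap * (S.ν * ‖S.D (u - w)‖) * ‖S.D χ‖ := by ring
    _ ≤ _ := by
        have := S.kap_nonneg
        gcongr
        exact h.norm_sub_le

/-- The Picard operator is Lipschitz with constant `κ`. -/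
theorem IsSol.lipschitz {u w u' w' : Y} (h : S.IsSol u w) (h' : S.IsSol u' w') :
    ‖S.D (w - w')‖ ≤ S.kap * ‖S.D (u - u')‖ := by
  have h1 : S.ν * ‖S.D (w - w')‖ ^ 2 = - S.b (u - u') w' (w - w') := by
    have h3 := S.skew u (w - w')
    rw [map_sub (S.b u), LinearMap.sub_apply] at h3
    have h4 := h (w - w')
    have h5 := h' (w - w')
    have e : ‖S.D (w - w')‖ ^ 2 =
        inner ℝ (S.D w) (S.D (w - w')) - inner ℝ (S.D w') (S.D (w - w')) := by
      rw [← inner_sub_left, ← map_sub, real_inner_self_eq_norm_sq]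
    rw [e, map_sub S.b, LinearMap.sub_apply, LinearMap.sub_apply]
    linarith
  have h2 := (neg_le_abs _).trans (S.abs_b_le (u - u') w' (w - w'))
  rw [← h1] at h2
  rcases (norm_nonneg (S.D (w - w'))).eq_or_lt with h0 | h0
  · rw [← h0]; exact mul_nonneg S.kap_nonneg (norm_nonneg _)
  · refine le_of_mul_le_mul_right ?_ (mul_pos S.ν_pos h0)
    calc _ = S.ν * ‖S.D (w - w')‖ ^ 2 := by ring
      _ ≤ _ := h2
      _ = (S.M * ‖S.D w'‖) * (‖S.D (u - u')‖ * ‖S.D (w - w')‖) := by ring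
      _ ≤ (S.kap * S.ν) * (‖S.D (u - u')‖ * ‖S.D (w - w')‖) :=
          mul_le_mul_of_nonneg_right h'.mul_norm_le (by positivity)
      _ = _ := by ring

/-- For `κ < 1`, differences of Picard iterates are controlled by residuals: absorb
`‖q(u) - q(u')‖ ≤ κ ‖u - u'‖` into `‖u - u'‖ ≤ ‖u - q(u)‖ + ‖q(u) - q(u')‖ + ‖q(u') - u'‖`. -/
theorem IsSol.norm_sub_le_res {u w u' w' : Y} (h : S.IsSol u w) (h' : S.IsSol u' w')
    (hκ : S.kap < 1) :
    ‖S.D (w - w')‖ ≤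
      S.kap / (S.ν * (1 - S.kap)) * (S.dnorm (S.res u) + S.dnorm (S.res u')) := by
  have h1 := h.lipschitz h'
  have h2 := h.norm_sub_le
  have h3 := h'.norm_sub_le
  have h4 : ‖S.D (u - u')‖ ≤ ‖S.D (u - w)‖ + ‖S.D (w - w')‖ + ‖S.D (u' - w')‖ := by
    have e : S.D (u - u') = S.D (u - w) + S.D (w - w') - S.D (u' - w') := by
      simp only [map_sub]; abel
    rw [e]
    exact (_root_.norm_sub_le _ _).trans (add_le_add (norm_add_le _ _) le_rfl)
  have hν := S.ν_pos
  have hpos : 0 < S.ν * (1 - S.kap) := mul_pos hν (by linarith)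
  have h5 : S.ν * (1 - S.kap) * ‖S.D (u - u')‖ ≤ S.dnorm (S.res u) + S.dnorm (S.res u') := by
    have : (1 - S.kap) * ‖S.D (u - u')‖ ≤ ‖S.D (u - w)‖ + ‖S.D (u' - w')‖ := by linarith
    nlinarith [mul_le_mul_of_nonneg_left this hν.le]
  rw [div_mul_eq_mul_div, le_div_iff₀ hpos]
  calc _ ≤ S.kap * ‖S.D (u - u')‖ * (S.ν * (1 - S.kap)) := by gcongr
    _ = S.kap * (S.ν * (1 - S.kap) * ‖S.D (u - u')‖) := by ring
    _ ≤ _ := mul_le_mul_of_nonneg_left h5 S.kap_nonneg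

variable (S)

/-- For an affine combination, the residual is affine up to a quadratic remainder in the
differences, since `∑ aᵢ Q(wᵢ) - Q(∑ aᵢ wᵢ) = ½ ∑ᵢⱼ aᵢ aⱼ Q(wᵢ - wⱼ)` for the quadratic form
`Q(w) = b(w, w, ·)`. -/
theorem res_sum {ι : Type*} (s : Finset ι) (a : ι → ℝ) (w : ι → Y) (ha : ∑ i ∈ s, a i = 1)
    (χ : Y) :
    S.res (∑ i ∈ s, a i • w i) χ = (∑ i ∈ s, a i • S.res (w i)) χ -
      1 / 2 * ∑ i ∈ s, ∑ j ∈ s, a i * a j * S.b (w i - w j) (w i - w j) χ := by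
  set B : ι → ι → ℝ := fun i j => S.b (w i) (w j) χ with hB
  have hquad : ∑ i ∈ s, ∑ j ∈ s, a i * a j * S.b (w i - w j) (w i - w j) χ =
      2 * ∑ i ∈ s, a i * B i i - 2 * ∑ i ∈ s, ∑ j ∈ s, a i * a j * B i j := by
    have e : ∀ i j, a i * a j * S.b (w i - w j) (w i - w j) χ =
        a j * (a i * B i i) + a i * (a j * B j j) - a i * a j * B i j - a j * a i * B j i := by
      intro i j
      simp only [hB, map_sub, LinearMap.sub_apply]
      ring
    simp only [e, Finset.sum_sub_distrib, Finset.sum_add_distrib]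
    have e1 : ∑ i ∈ s, ∑ j ∈ s, a j * (a i * B i i) = ∑ i ∈ s, a i * B i i := by
      simp only [← Finset.sum_mul, ha, one_mul]
    have e2 : ∑ i ∈ s, ∑ j ∈ s, a i * (a j * B j j) = ∑ i ∈ s, a i * B i i := by
      simp only [← Finset.mul_sum, ← Finset.sum_mul, ha, one_mul]
    have e3 : ∑ i ∈ s, ∑ j ∈ s, a j * a i * B j i = ∑ i ∈ s, ∑ j ∈ s, a i * a j * B i j :=
      Finset.sum_comm
    rw [e1, e2, e3]
    ring
  have hb : S.b (∑ i ∈ s, a i • w i) (∑ i ∈ s, a i • w i) χ =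
      ∑ i ∈ s, ∑ j ∈ s, a i * a j * B i j := by
    simp only [map_sum, map_smul, LinearMap.sum_apply, LinearMap.smul_apply, smul_eq_mul, hB,
      Finset.mul_sum, mul_assoc]
    rw [Finset.sum_comm]
    refine Finset.sum_congr rfl fun i _ => Finset.sum_congr rfl fun j _ => ?_
    ring
  have hF : S.F χ = ∑ i ∈ s, a i * S.F χ := by rw [← Finset.sum_mul, ha, one_mul]
  rw [hquad, S.res_apply, hb, hF]
  simp only [LinearMap.sum_apply, LinearMap.smul_apply, smul_eq_mul, S.res_apply, map_sum,
    map_smul, sum_inner, inner_smul_left, mul_add, mul_sub, Finset.sum_add_distrib,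
    Finset.sum_sub_distrib, Finset.mul_sum, hB]
  have : ∀ i, S.ν * ((starRingEnd ℝ) (a i) * inner ℝ (S.D (w i)) (S.D χ)) =
      a i * (S.ν * inner ℝ (S.D (w i)) (S.D χ)) := fun i => by
    simp only [conj_trivial]; ring
  simp only [this]
  simp only [← Finset.mul_sum]
  ring

/-- The residual of an affine combination of Picard iterates. The argument gives the factor
`2 (n + 1)` in the quadratic term; it is enlarged to `4 (n + 1) n³`. -/
theorem dnorm_res_sum_le {n : ℕ} (hn : 1 ≤ n) (a : ℕ → ℝ) {A : ℝ}
    (hA : ∀ i ∈ Finset.range (n + 1), |a i| ≤ A)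
    (ha : ∑ i ∈ Finset.range (n + 1), a i = 1) (u w : ℕ → Y) (h : ∀ i, S.IsSol (u i) (w i))
    (hκ : S.kap < 1) :
    S.dnorm (S.res (∑ i ∈ Finset.range (n + 1), a i • w i)) ≤
      S.dnorm (∑ i ∈ Finset.range (n + 1), a i • S.res (w i)) +
        4 * S.M * ((n : ℝ) + 1) * (n : ℝ) ^ 3 * A ^ 2 *
          (S.kap ^ 2 / (S.ν ^ 2 * (1 - S.kap) ^ 2)) *
          ∑ i ∈ Finset.range (n + 1), S.dnorm (S.res (u i)) ^ 2 := by
  set s := Finset.range (n + 1) with hs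
  set G : ℕ → ℝ := fun i => S.dnorm (S.res (u i)) with hG
  set c := S.kap / (S.ν * (1 - S.kap)) with hc
  have hc2 : S.kap ^ 2 / (S.ν ^ 2 * (1 - S.kap) ^ 2) = c ^ 2 := by
    rw [hc, div_pow, mul_pow]
  rw [hc2]
  have hM := S.M_nonneg
  have hbd : IsDualBounded S.D (∑ i ∈ s, a i • S.res (w i)) :=
    IsDualBounded.sum_smul s a fun i => S.isDualBounded_res (w i)
  have hsum0 : 0 ≤ ∑ i ∈ s, G i ^ 2 := Finset.sum_nonneg fun i _ => sq_nonneg _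
  have hcard : ∑ i ∈ s, ∑ j ∈ s, 2 * (G i ^ 2 + G j ^ 2) =
      4 * ((n : ℝ) + 1) * ∑ i ∈ s, G i ^ 2 := by
    simp only [← Finset.mul_sum, Finset.sum_add_distrib, Finset.sum_const, hs,
      Finset.card_range, nsmul_eq_mul]
    push_cast
    ring
  have hterm : ∀ χ, ∀ i ∈ s, ∀ j ∈ s, |a i * a j * S.b (w i - w j) (w i - w j) χ| ≤
      A ^ 2 * S.M * c ^ 2 * ‖S.D χ‖ * (2 * (G i ^ 2 + G j ^ 2)) := by
    intro χ i hi j hj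
    have hA0 : 0 ≤ A := (abs_nonneg _).trans (hA i hi)
    have hd := (h i).norm_sub_le_res (h j) hκ
    have hsq : ‖S.D (w i - w j)‖ ^ 2 ≤ c ^ 2 * (2 * (G i ^ 2 + G j ^ 2)) := by
      calc _ ≤ (c * (G i + G j)) ^ 2 := by gcongr
        _ = c ^ 2 * (G i + G j) ^ 2 := by ring
        _ ≤ _ := by gcongr; nlinarith [sq_nonneg (G i - G j)]
    rw [abs_mul, abs_mul]
    calc _ ≤ (A * A) * (S.M * ‖S.D (w i - w j)‖ * ‖S.D (w i - w j)‖ * ‖S.D χ‖) := by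
          gcongr
          · exact hA i hi
          · exact hA j hj
          · exact S.abs_b_le _ _ _
      _ = A ^ 2 * S.M * ‖S.D χ‖ * ‖S.D (w i - w j)‖ ^ 2 := by ring
      _ ≤ A ^ 2 * S.M * ‖S.D χ‖ * (c ^ 2 * (2 * (G i ^ 2 + G j ^ 2))) := by gcongr
      _ = _ := by ring
  refine dualNorm_le (add_nonneg (dualNorm_nonneg S.injective hbd) (by positivity)) fun χ => ?_
  rw [S.res_sum s a w ha]
  have h1 := le_dualNorm_mul S.injective hbd χ
  have h2 : |∑ i ∈ s, ∑ j ∈ s, a i * a j * S.b (w i - w j) (w i - w j) χ| ≤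
      A ^ 2 * S.M * c ^ 2 * ‖S.D χ‖ * (4 * ((n : ℝ) + 1) * ∑ i ∈ s, G i ^ 2) := by
    rw [← hcard]
    simp only [Finset.mul_sum]
    refine (Finset.abs_sum_le_sum_abs _ _).trans (Finset.sum_le_sum fun i hi => ?_)
    refine (Finset.abs_sum_le_sum_abs _ _).trans (Finset.sum_le_sum fun j hj => ?_)
    refine (hterm χ i hi j hj).trans (le_of_eq ?_)
    ring
  have hn1 : (1 : ℝ) ≤ (n : ℝ) ^ 3 := one_le_pow₀ (by exact_mod_cast hn)
  have h3 : A ^ 2 * S.M * c ^ 2 * ‖S.D χ‖ * (4 * ((n : ℝ) + 1) * ∑ i ∈ s, G i ^ 2) * 1 ≤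
      A ^ 2 * S.M * c ^ 2 * ‖S.D χ‖ * (4 * ((n : ℝ) + 1) * ∑ i ∈ s, G i ^ 2) * (n : ℝ) ^ 3 :=
    mul_le_mul_of_nonneg_left hn1 (by positivity)
  have h4 := (neg_le_abs _).trans h2
  have h5 : 0 ≤ A ^ 2 * S.M * c ^ 2 * ‖S.D χ‖ * (4 * ((n : ℝ) + 1) * ∑ i ∈ s, G i ^ 2) := by
    positivity
  have e : 4 * S.M * ((n : ℝ) + 1) * (n : ℝ) ^ 3 * A ^ 2 * c ^ 2 * (∑ i ∈ s, G i ^ 2) * ‖S.D χ‖ =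
      A ^ 2 * S.M * c ^ 2 * ‖S.D χ‖ * (4 * ((n : ℝ) + 1) * ∑ i ∈ s, G i ^ 2) * (n : ℝ) ^ 3 := by
    ring
  rw [add_mul, e]
  unfold dnorm
  linarith

end FlowData

/-! ### Sobolev and Poincaré inequalities on the closure of the test fields -/

section Sobolev

open scoped NNReal ENNReal
open Filter Topology

variable {d : ℕ} {Ω : Set (Euc d)}

theorem norm_le_sum_norm_single {F : Type*} [NormedAddCommGroup F] [NormedSpace ℝ F]
    (L : Euc d →L[ℝ] F) : ‖L‖ ≤ ∑ i, ‖L (EuclideanSpace.single i 1)‖ := by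
  refine L.opNorm_le_bound (Finset.sum_nonneg fun i _ => norm_nonneg _) fun x => ?_
  have hx : x = ∑ i, x i • EuclideanSpace.single i (1 : ℝ) := by
    ext j
    simp [Finset.sum_apply, Pi.single_apply]
  calc ‖L x‖ = ‖∑ i, x i • L (EuclideanSpace.single i 1)‖ := by
        conv_lhs => rw [hx, map_sum]
        simp only [map_smul]
    _ ≤ ∑ i, ‖x i • L (EuclideanSpace.single i 1)‖ := norm_sum_le _ _
    _ ≤ ∑ i, ‖L (EuclideanSpace.single i 1)‖ * ‖x‖ := by
        refine Finset.sum_le_sum fun i _ => ?_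
        rw [norm_smul, mul_comm]
        exact mul_le_mul_of_nonneg_left (PiLp.norm_apply_le x i) (norm_nonneg _)
    _ = _ := by rw [Finset.sum_mul]

/-- The Gagliardo–Nirenberg–Sobolev inequality `‖φ‖₄ ≤ C ‖∇φ‖₂` for test fields. -/
theorem exists_eLpNorm_four_le_of_isTestFun (hd : d = 2 ∨ d = 3)
    (hΩb : Bornology.IsBounded Ω) :
    ∃ C : ℝ≥0, ∀ φ : Euc d → Euc d, IsTestFun Ω φ →
      eLpNorm φ 4 (volume.restrict Ω) ≤
        C * ∑ i, eLpNorm (partialDeriv i φ) 2 (volume.restrict Ω) := by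
  -- In dimension two the Sobolev exponent must be subcritical, `p < 2`.
  obtain ⟨p, hp1, hpd, hp4, hp2⟩ : ∃ p : ℝ≥0, 1 ≤ p ∧ p < d ∧
      (p : ℝ)⁻¹ - (d : ℝ)⁻¹ ≤ (4 : ℝ)⁻¹ ∧ p ≤ 2 := by
    rcases hd with rfl | rfl
    · refine ⟨3 / 2, ?_, ?_, ?_, ?_⟩
      · rw [← NNReal.coe_le_coe]; push_cast; norm_num
      · rw [← NNReal.coe_lt_coe]; push_cast; norm_num
      · push_cast; norm_num
      · rw [← NNReal.coe_le_coe]; push_cast; norm_num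
    · refine ⟨2, ?_, ?_, ?_, le_rfl⟩
      · rw [← NNReal.coe_le_coe]; push_cast; norm_num
      · rw [← NNReal.coe_lt_coe]; push_cast; norm_num
      · push_cast; norm_num
  have hfin : IsFiniteMeasure ((volume : Measure (Euc d)).restrict Ω) :=
    ⟨by rw [Measure.restrict_apply_univ]; exact hΩb.measure_lt_top⟩
  set c : ℝ≥0∞ := (volume.restrict Ω) Set.univ ^ (1 / (p : ℝ≥0∞).toReal - 1 / (2 : ℝ≥0∞).toReal)
    with hc
  have hctop : c ≠ ⊤ := by
    refine ENNReal.rpow_ne_top_of_nonneg ?_ (measure_ne_top _ _)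
    have h2 : (p : ℝ) ≤ 2 := by exact_mod_cast hp2
    have h1 : (0 : ℝ) < p := lt_of_lt_of_le one_pos (by exact_mod_cast hp1)
    simp only [ENNReal.coe_toReal, ENNReal.toReal_ofNat]
    exact sub_nonneg.2 (one_div_le_one_div_of_le h1 h2)
  refine ⟨eLpNormLESNormFDerivOfLeConst (Euc d) (volume : Measure (Euc d)) Ω p 4 * c.toNNReal,
    fun φ hφ => ?_⟩
  have hsub : Function.support φ ⊆ Ω := (subset_tsupport φ).trans hφ.2.2
  have h1 := eLpNorm_le_eLpNorm_fderiv_of_le (F := Euc d) (volume : Measure (Euc d))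
    (u := φ) (s := Ω) (hφ.1.of_le (by exact_mod_cast le_top)) hsub (p := p) (q := 4) hp1
    (by rw [finrank_euclideanSpace_fin]; exact hpd)
    (by rw [finrank_euclideanSpace_fin]; exact_mod_cast hp4) hΩb
  have hsub' : Function.support (fderiv ℝ φ) ⊆ Ω := (support_fderiv_subset ℝ).trans hφ.2.2
  have hmeas : AEStronglyMeasurable (fderiv ℝ φ) (volume.restrict Ω) :=
    (hφ.1.continuous_fderiv (by simp)).aestronglyMeasurable
  have h2 : eLpNorm (fderiv ℝ φ) p (volume.restrict Ω) ≤
      eLpNorm (fderiv ℝ φ) 2 (volume.restrict Ω) * c :=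
    eLpNorm_le_eLpNorm_mul_rpow_measure_univ (by exact_mod_cast hp2) hmeas
  have h3 : eLpNorm (fderiv ℝ φ) 2 (volume.restrict Ω) ≤
      ∑ i, eLpNorm (partialDeriv i φ) 2 (volume.restrict Ω) := by
    calc _ ≤ eLpNorm (∑ i, fun x => ‖partialDeriv i φ x‖) 2 (volume.restrict Ω) := by
          refine eLpNorm_mono_real fun x => ?_
          rw [Finset.sum_apply]
          exact norm_le_sum_norm_single _
      _ ≤ ∑ i, eLpNorm (fun x => ‖partialDeriv i φ x‖) 2 (volume.restrict Ω) :=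
          eLpNorm_sum_le (fun i _ => (hφ.memLp_partialDeriv i).1.norm) (by norm_num)
      _ = _ := by simp only [eLpNorm_norm]
  calc eLpNorm φ 4 (volume.restrict Ω) ≤ eLpNorm φ 4 volume :=
        eLpNorm_mono_measure _ Measure.restrict_le_self
    _ ≤ _ := h1
    _ = eLpNormLESNormFDerivOfLeConst (Euc d) (volume : Measure (Euc d)) Ω p 4 *
          eLpNorm (fderiv ℝ φ) p (volume.restrict Ω) := by
        congr 1
        exact (eLpNorm_restrict_eq_of_support_subset hsub').symm
    _ ≤ eLpNormLESNormFDerivOfLeConst (Euc d) (volume : Measure (Euc d)) Ω p 4 *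
          ((∑ i, eLpNorm (partialDeriv i φ) 2 (volume.restrict Ω)) * c) := by
        gcongr
        exact h2.trans (mul_le_mul_left h3 c)
    _ = _ := by
        rw [ENNReal.coe_mul, ENNReal.coe_toNNReal hctop]
        ring

/-- The embedding `H¹₀ ⊂ L⁴` in dimensions two and three, with the gradient norm. -/
theorem exists_eLpNorm_four_le (hd : d = 2 ∨ d = 3) (hΩb : Bornology.IsBounded Ω) :
    ∃ C : ℝ, 0 ≤ C ∧ ∀ p ∈ (testFields Ω).topologicalClosure,
      eLpNorm p.fst 4 (volume.restrict Ω) ≤ ENNReal.ofReal (C * ‖p.snd‖) := by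
  obtain ⟨C, hC⟩ := exists_eLpNorm_four_le_of_isTestFun hd hΩb
  have htest : ∀ p ∈ testFields Ω,
      eLpNorm p.fst 4 (volume.restrict Ω) ≤ ENNReal.ofReal (C * d * ‖p.snd‖) := by
    rintro p ⟨φ, hφ, h1, h2⟩
    rw [eLpNorm_congr_ae h1]
    refine (hC φ hφ).trans ?_
    have h3 : ∀ i, eLpNorm (partialDeriv i φ) 2 (volume.restrict Ω) ≤
        ENNReal.ofReal ‖p.snd‖ := fun i => by
      rw [← eLpNorm_congr_ae (h2 i), ← Lp.enorm_def, ← ofReal_norm]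
      exact ENNReal.ofReal_le_ofReal (PiLp.norm_apply_le p.snd i)
    calc _ ≤ (C : ℝ≥0∞) * ∑ i : Fin d, ENNReal.ofReal ‖p.snd‖ := by
          gcongr with i
          exact h3 i
      _ = _ := by
          rw [Finset.sum_const, Finset.card_univ, Fintype.card_fin, nsmul_eq_mul,
            ENNReal.ofReal_mul (by positivity), ENNReal.ofReal_mul (by positivity),
            ENNReal.ofReal_coe_nnreal, ENNReal.ofReal_natCast, mul_assoc]
  refine ⟨C * d, by positivity, fun p hp => ?_⟩
  obtain ⟨s, hs, hlim⟩ := mem_closure_iff_seq_limit.1 hp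
  have hfst : Tendsto (fun n => (s n).fst) atTop (𝓝 p.fst) :=
    ((WithLp.prod_continuous_ofLp 2 _ _).fst.tendsto p).comp hlim
  have hsnd : Tendsto (fun n => ‖(s n).snd‖) atTop (𝓝 ‖p.snd‖) :=
    ((WithLp.prod_continuous_ofLp 2 _ _).snd.norm.tendsto p).comp hlim
  have hmeasure := tendstoInMeasure_of_tendsto_Lp hfst
  refine ENNReal.le_of_forall_pos_le_add fun ε hε _ => ?_
  refine eLpNorm_le_of_tendstoInMeasure ?_ hmeasure fun n => Lp.aestronglyMeasurable _
  have hb : Tendsto (fun n => (C * d : ℝ) * ‖(s n).snd‖) atTop (𝓝 (C * d * ‖p.snd‖)) :=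
    hsnd.const_mul _
  filter_upwards [hb.eventually_le_const (lt_add_of_pos_right _ (NNReal.coe_pos.2 hε))] with n hn
  refine (htest _ (hs n)).trans ((ENNReal.ofReal_le_ofReal hn).trans ?_)
  rw [ENNReal.ofReal_add (by positivity) (NNReal.coe_nonneg ε), ENNReal.ofReal_coe_nnreal]

/-- The Poincaré inequality, read off from the `L⁴` embedding on a domain of finite measure. -/
theorem exists_norm_fst_le (hd : d = 2 ∨ d = 3) (hΩb : Bornology.IsBounded Ω) :
    ∃ C : ℝ, 0 ≤ C ∧ ∀ p ∈ (testFields Ω).topologicalClosure, ‖p.fst‖ ≤ C * ‖p.snd‖ := by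
  obtain ⟨C, hC0, hC⟩ := exists_eLpNorm_four_le hd hΩb
  have hfin : IsFiniteMeasure ((volume : Measure (Euc d)).restrict Ω) :=
    ⟨by rw [Measure.restrict_apply_univ]; exact hΩb.measure_lt_top⟩
  set c : ℝ≥0∞ := (volume.restrict Ω) Set.univ ^
    (1 / (2 : ℝ≥0∞).toReal - 1 / (4 : ℝ≥0∞).toReal) with hc
  have hctop : c ≠ ⊤ := by
    refine ENNReal.rpow_ne_top_of_nonneg ?_ (measure_ne_top _ _)
    simp only [ENNReal.toReal_ofNat]
    norm_num
  refine ⟨C * c.toReal, by positivity, fun p hp => ?_⟩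
  have h1 : eLpNorm p.fst 2 (volume.restrict Ω) ≤ eLpNorm p.fst 4 (volume.restrict Ω) * c :=
    eLpNorm_le_eLpNorm_mul_rpow_measure_univ (by norm_num) (Lp.aestronglyMeasurable _)
  rw [Lp.norm_def]
  refine ENNReal.toReal_le_of_le_ofReal (by positivity) (h1.trans ?_)
  calc _ ≤ ENNReal.ofReal (C * ‖p.snd‖) * c := mul_le_mul_left (hC p hp) c
    _ = ENNReal.ofReal (C * ‖p.snd‖) * ENNReal.ofReal c.toReal := by
        rw [ENNReal.ofReal_toReal hctop]
    _ = _ := by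
        rw [← ENNReal.ofReal_mul (by positivity)]
        congr 1
        ring

end Sobolev

/-! ### The convective form -/

section Convection

open scoped NNReal ENNReal

variable {d : ℕ} {Ω : Set (Euc d)}

instance holderTriple_four_four_two : ENNReal.HolderTriple 4 4 2 where
  inv_add_inv_eq_inv := by
    have : (2 : ℝ≥0∞)⁻¹ = 2 * (4 : ℝ≥0∞)⁻¹ := by
      rw [show (4 : ℝ≥0∞) = 2 * 2 by norm_num, ENNReal.mul_inv (by simp) (by simp), ← mul_assoc,
        ENNReal.mul_inv_cancel (by simp) (by simp), one_mul]
    rw [this, two_mul]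

variable {u v w : L2Pair Ω}

/-- Hölder's inequality with exponents `4, 2, 4` for one summand of the convective form. -/
theorem eLpNorm_convection_term_le (i : Fin d) :
    eLpNorm (fun x => u.fst x i * inner ℝ (v.snd i x) (w.fst x)) 1 (volume.restrict Ω) ≤
      eLpNorm (v.snd i) 2 (volume.restrict Ω) *
        (eLpNorm u.fst 4 (volume.restrict Ω) * eLpNorm w.fst 4 (volume.restrict Ω)) := by
  have hu := Lp.aestronglyMeasurable u.fst
  have hw := Lp.aestronglyMeasurable w.fst
  have hui : AEStronglyMeasurable (fun x => u.fst x i) (volume.restrict Ω) :=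
    (EuclideanSpace.proj i : Euc d →L[ℝ] ℝ).continuous.comp_aestronglyMeasurable hu
  have h1 : eLpNorm (fun x => u.fst x i • w.fst x) 2 (volume.restrict Ω) ≤
      (1 : ℝ≥0) * eLpNorm u.fst 4 (volume.restrict Ω) * eLpNorm w.fst 4 (volume.restrict Ω) := by
    refine eLpNorm_le_eLpNorm_mul_eLpNorm'_of_norm hu hw (fun y z => y i • z) 1
      (Filter.Eventually.of_forall fun x => ?_)
    rw [norm_smul, NNReal.coe_one, one_mul]
    exact mul_le_mul_of_nonneg_right (PiLp.norm_apply_le _ i) (norm_nonneg _)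
  have h2 : eLpNorm (fun x => inner ℝ (v.snd i x) (u.fst x i • w.fst x)) 1 (volume.restrict Ω) ≤
      (1 : ℝ≥0) * eLpNorm (v.snd i) 2 (volume.restrict Ω) *
        eLpNorm (fun x => u.fst x i • w.fst x) 2 (volume.restrict Ω) := by
    refine eLpNorm_le_eLpNorm_mul_eLpNorm'_of_norm (Lp.aestronglyMeasurable _) (hui.smul hw)
      (fun y z => inner ℝ y z) 1 (Filter.Eventually.of_forall fun x => ?_)
    rw [NNReal.coe_one, one_mul]
    exact norm_inner_le_norm _ _
  simp only [real_inner_smul_right, ENNReal.coe_one, one_mul] at h1 h2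
  exact h2.trans (by gcongr)

theorem integrable_convection_term (hu : eLpNorm u.fst 4 (volume.restrict Ω) ≠ ⊤)
    (hw : eLpNorm w.fst 4 (volume.restrict Ω) ≠ ⊤) (i : Fin d) :
    Integrable (fun x => u.fst x i * inner ℝ (v.snd i x) (w.fst x)) (volume.restrict Ω) := by
  rw [← memLp_one_iff_integrable]
  refine ⟨?_, eLpNorm_convection_term_le i |>.trans_lt ?_⟩
  · exact ((EuclideanSpace.proj i : Euc d →L[ℝ] ℝ).continuous.comp_aestronglyMeasurable
      (Lp.aestronglyMeasurable u.fst)).mul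
      ((Lp.aestronglyMeasurable _).inner (Lp.aestronglyMeasurable _))
  · exact ENNReal.mul_lt_top (Lp.memLp (v.snd i)).eLpNorm_lt_top
      (ENNReal.mul_lt_top hu.lt_top hw.lt_top)

theorem integrable_convection (hu : eLpNorm u.fst 4 (volume.restrict Ω) ≠ ⊤)
    (hw : eLpNorm w.fst 4 (volume.restrict Ω) ≠ ⊤) :
    Integrable (fun x => ∑ i, u.fst x i * inner ℝ (v.snd i x) (w.fst x)) (volume.restrict Ω) :=
  integrable_finsetSum _ fun i _ => integrable_convection_term hu hw i

theorem abs_convection_le {a c : ℝ} (ha : 0 ≤ a) (hc : 0 ≤ c)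
    (hu : eLpNorm u.fst 4 (volume.restrict Ω) ≤ ENNReal.ofReal a)
    (hw : eLpNorm w.fst 4 (volume.restrict Ω) ≤ ENNReal.ofReal c) :
    |convection u v w| ≤ d * (‖v.snd‖ * (a * c)) := by
  have hu' := ne_top_of_le_ne_top ENNReal.ofReal_ne_top hu
  have hw' := ne_top_of_le_ne_top ENNReal.ofReal_ne_top hw
  unfold convection
  rw [integral_finsetSum _ fun i _ => integrable_convection_term hu' hw' i]
  refine (Finset.abs_sum_le_sum_abs _ _).trans ?_
  have : ∀ i ∈ Finset.univ, |∫ x in Ω, u.fst x i * inner ℝ (v.snd i x) (w.fst x)| ≤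
      ‖v.snd‖ * (a * c) := by
    intro i _
    rw [← Real.norm_eq_abs]
    refine (norm_integral_le_lintegral_norm _).trans ?_
    refine ENNReal.toReal_le_of_le_ofReal (by positivity) ?_
    simp only [ofReal_norm]
    rw [← eLpNorm_one_eq_lintegral_enorm]
    refine (eLpNorm_convection_term_le i).trans ?_
    rw [ENNReal.ofReal_mul (norm_nonneg _), ENNReal.ofReal_mul ha]
    gcongr
    rw [← Lp.enorm_def, ← ofReal_norm]
    exact ENNReal.ofReal_le_ofReal (PiLp.norm_apply_le v.snd i)
  refine (Finset.sum_le_sum this).trans (le_of_eq ?_)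
  rw [Finset.sum_const, Finset.card_univ, Fintype.card_fin, nsmul_eq_mul]

end Convection

section ConvectionForm

variable {d : ℕ} {Ω : Set (Euc d)} {u u' v v' w w' : L2Pair Ω}

theorem convection_add_left (hu : eLpNorm u.fst 4 (volume.restrict Ω) ≠ ⊤)
    (hu' : eLpNorm u'.fst 4 (volume.restrict Ω) ≠ ⊤)
    (hw : eLpNorm w.fst 4 (volume.restrict Ω) ≠ ⊤) :
    convection (u + u') v w = convection u v w + convection u' v w := by
  unfold convection
  rw [← integral_add (integrable_convection hu hw) (integrable_convection hu' hw)]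
  refine integral_congr_ae ?_
  filter_upwards [Lp.coeFn_add u.fst u'.fst] with x hx
  rw [WithLp.add_fst, hx, ← Finset.sum_add_distrib]
  refine Finset.sum_congr rfl fun i _ => ?_
  rw [Pi.add_apply, PiLp.add_apply, add_mul]

theorem convection_add_middle (hu : eLpNorm u.fst 4 (volume.restrict Ω) ≠ ⊤)
    (hw : eLpNorm w.fst 4 (volume.restrict Ω) ≠ ⊤) :
    convection u (v + v') w = convection u v w + convection u v' w := by
  unfold convection
  rw [← integral_add (integrable_convection hu hw) (integrable_convection hu hw)]
  refine integral_congr_ae ?_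
  have hall : ∀ᵐ x ∂(volume.restrict Ω), ∀ i,
      (v.snd i + v'.snd i : L2Vec Ω) x = v.snd i x + v'.snd i x :=
    ae_all_iff.2 fun i => Lp.coeFn_add _ _
  filter_upwards [hall] with x hx
  rw [← Finset.sum_add_distrib]
  refine Finset.sum_congr rfl fun i _ => ?_
  rw [WithLp.add_snd, PiLp.add_apply, hx, inner_add_left, mul_add]

theorem convection_add_right (hu : eLpNorm u.fst 4 (volume.restrict Ω) ≠ ⊤)
    (hw : eLpNorm w.fst 4 (volume.restrict Ω) ≠ ⊤)
    (hw' : eLpNorm w'.fst 4 (volume.restrict Ω) ≠ ⊤) :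
    convection u v (w + w') = convection u v w + convection u v w' := by
  unfold convection
  rw [← integral_add (integrable_convection hu hw) (integrable_convection hu hw')]
  refine integral_congr_ae ?_
  filter_upwards [Lp.coeFn_add w.fst w'.fst] with x hx
  rw [WithLp.add_fst, hx, ← Finset.sum_add_distrib]
  refine Finset.sum_congr rfl fun i _ => ?_
  rw [Pi.add_apply, inner_add_right, mul_add]

theorem convection_smul_left (c : ℝ) : convection (c • u) v w = c * convection u v w := by
  unfold convection
  rw [← integral_const_mul]
  refine integral_congr_ae ?_
  filter_upwards [Lp.coeFn_smul c u.fst] with x hx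
  rw [WithLp.smul_fst, hx, Finset.mul_sum]
  refine Finset.sum_congr rfl fun i _ => ?_
  rw [Pi.smul_apply, PiLp.smul_apply, smul_eq_mul, mul_assoc]

theorem convection_smul_middle (c : ℝ) : convection u (c • v) w = c * convection u v w := by
  unfold convection
  rw [← integral_const_mul]
  refine integral_congr_ae ?_
  have hall : ∀ᵐ x ∂(volume.restrict Ω), ∀ i, (c • v.snd i : L2Vec Ω) x = c • v.snd i x :=
    ae_all_iff.2 fun i => Lp.coeFn_smul _ _
  filter_upwards [hall] with x hx
  rw [Finset.mul_sum]
  refine Finset.sum_congr rfl fun i _ => ?_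
  rw [WithLp.smul_snd, PiLp.smul_apply, hx, real_inner_smul_left]
  ring

theorem convection_smul_right (c : ℝ) : convection u v (c • w) = c * convection u v w := by
  unfold convection
  rw [← integral_const_mul]
  refine integral_congr_ae ?_
  filter_upwards [Lp.coeFn_smul c w.fst] with x hx
  rw [WithLp.smul_fst, hx, Finset.mul_sum]
  refine Finset.sum_congr rfl fun i _ => ?_
  rw [Pi.smul_apply, real_inner_smul_right]
  ring

/-- The convective form as a trilinear form, on any space of pairs whose fields lie in `L⁴`. -/
noncomputable def convectionForm {Z : Type*} [AddCommGroup Z] [Module ℝ Z]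
    (e : Z →ₗ[ℝ] L2Pair Ω) (h : ∀ z, eLpNorm (e z).fst 4 (volume.restrict Ω) ≠ ⊤) :
    Z →ₗ[ℝ] Z →ₗ[ℝ] Z →ₗ[ℝ] ℝ where
  toFun u := LinearMap.mk₂ ℝ (fun v w => convection (e u) (e v) (e w))
    (fun v v' w => by rw [map_add, convection_add_middle (h _) (h _)])
    (fun c v w => by rw [map_smul, convection_smul_middle, smul_eq_mul])
    (fun v w w' => by rw [map_add, convection_add_right (h _) (h _) (h _)])
    (fun c v w => by rw [map_smul, convection_smul_right, smul_eq_mul])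
  map_add' u u' := by
    ext v w
    simp only [LinearMap.mk₂_apply, LinearMap.add_apply]
    rw [map_add, convection_add_left (h _) (h _) (h _)]
  map_smul' c u := by
    ext v w
    simp only [LinearMap.mk₂_apply, LinearMap.smul_apply, RingHom.id_apply]
    rw [map_smul, convection_smul_left, smul_eq_mul]

end ConvectionForm

/-! ### Closedness of the velocity spaces -/

section Closed

variable {d : ℕ} {Ω : Set (Euc d)}

theorem norm_integral_smul_le {ψ : Euc d → ℝ} (hψ : MemLp ψ 2 (volume.restrict Ω))
    (u : L2Vec Ω) :
    ‖∫ x in Ω, ψ x • u x‖ ≤ (eLpNorm ψ 2 (volume.restrict Ω)).toReal * ‖u‖ := by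
  have h : eLpNorm (ψ • (u : Euc d → Euc d)) 1 (volume.restrict Ω) ≤
      eLpNorm ψ 2 (volume.restrict Ω) * eLpNorm u 2 (volume.restrict Ω) :=
    eLpNorm_smul_le_mul_eLpNorm (f := (u : Euc d → Euc d)) (φ := ψ) (Lp.memLp u).1 hψ.1
  refine (norm_integral_le_lintegral_norm _).trans ?_
  simp only [ofReal_norm]
  rw [← eLpNorm_one_eq_lintegral_enorm, Lp.norm_def, ← ENNReal.toReal_mul]
  exact ENNReal.toReal_mono
    (ENNReal.mul_ne_top hψ.eLpNorm_ne_top (Lp.memLp u).eLpNorm_ne_top) h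

/-- Integration against a fixed `L²` weight, as a continuous linear map on `L²`. -/
noncomputable def weightedIntegral (ψ : Euc d → ℝ) (hψ : MemLp ψ 2 (volume.restrict Ω)) :
    L2Vec Ω →L[ℝ] Euc d :=
  LinearMap.mkContinuous
    { toFun := fun u => ∫ x in Ω, ψ x • u x
      map_add' := integral_smul_add hψ
      map_smul' := integral_smul_smul ψ }
    (eLpNorm ψ 2 (volume.restrict Ω)).toReal (norm_integral_smul_le hψ)

theorem weightedIntegral_apply (ψ : Euc d → ℝ) (hψ : MemLp ψ 2 (volume.restrict Ω))
    (u : L2Vec Ω) : weightedIntegral ψ hψ u = ∫ x in Ω, ψ x • u x := rfl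

theorem weightedIntegral_apply_coord (ψ : Euc d → ℝ) (hψ : MemLp ψ 2 (volume.restrict Ω))
    (u : L2Vec Ω) (i : Fin d) : weightedIntegral ψ hψ u i = ∫ x in Ω, ψ x * u x i := by
  rw [weightedIntegral_apply]
  exact ((EuclideanSpace.proj i : Euc d →L[ℝ] ℝ).integral_comp_comm
    (integrable_smul_L2 hψ u)).symm

theorem integral_mul_divergence (p : L2Pair Ω) (ψ : Euc d → ℝ)
    (hψ : MemLp ψ 2 (volume.restrict Ω)) :
    ∫ x in Ω, ψ x * divergence p x = ∑ i, weightedIntegral ψ hψ (p.snd i) i := by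
  simp only [weightedIntegral_apply_coord, divergence, Finset.mul_sum]
  refine integral_finsetSum _ fun i _ => ?_
  exact (EuclideanSpace.proj i : Euc d →L[ℝ] ℝ).integrable_comp (integrable_smul_L2 hψ (p.snd i))

theorem continuous_snd_apply (i : Fin d) : Continuous fun p : L2Pair Ω => p.snd i :=
  (PiLp.continuous_apply 2 _ i).comp (WithLp.prod_continuous_ofLp 2 _ _).snd

theorem continuous_fst : Continuous fun p : L2Pair Ω => p.fst :=
  (WithLp.prod_continuous_ofLp 2 _ _).fst

theorem continuous_integral_mul_divergence (ψ : Euc d → ℝ)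
    (hψ : MemLp ψ 2 (volume.restrict Ω)) :
    Continuous fun p : L2Pair Ω => ∫ x in Ω, ψ x * divergence p x := by
  simp only [integral_mul_divergence _ ψ hψ]
  refine continuous_finsetSum _ fun i _ => ?_
  exact (EuclideanSpace.proj i : Euc d →L[ℝ] ℝ).continuous.comp
    ((weightedIntegral ψ hψ).continuous.comp (continuous_snd_apply i))

theorem isClosed_H1 : IsClosed (H1 Ω : Set (L2Pair Ω)) := by
  have : (H1 Ω : Set (L2Pair Ω)) = ⋂ i, ⋂ φ : {φ : Euc d → ℝ // IsTestFun Ω φ},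
      {p | weightedIntegral _ (φ.2.memLp_partialDeriv i) p.fst =
        - weightedIntegral _ φ.2.memLp (p.snd i)} := by
    ext p
    simp only [Set.mem_iInter, Set.mem_ofPred_eq, Subtype.forall]
    rfl
  rw [this]
  refine isClosed_iInter fun i => isClosed_iInter fun φ => isClosed_eq ?_ ?_
  · exact (weightedIntegral _ _).continuous.comp continuous_fst
  · exact ((weightedIntegral _ _).continuous.comp (continuous_snd_apply i)).neg

/-- The space `V` as a subspace of the pairs `(u, ∇u)` rather than of `X`. -/
noncomputable def velocity (Ω : Set (Euc d)) : Submodule ℝ (L2Pair Ω) := (V Ω).map (X Ω).subtype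

theorem coe_mem_velocity (v : V Ω) : (v : L2Pair Ω) ∈ velocity Ω :=
  Submodule.mem_map_of_mem v.2

theorem exists_eq_coe_of_mem_velocity {p : L2Pair Ω} (hp : p ∈ velocity Ω) :
    ∃ v : V Ω, (v : L2Pair Ω) = p := by
  obtain ⟨v, hv, rfl⟩ := hp
  exact ⟨⟨v, hv⟩, rfl⟩

theorem velocity_le_X : velocity Ω ≤ X Ω := Submodule.map_subtype_le _ _

theorem isClosed_velocity : IsClosed (velocity Ω : Set (L2Pair Ω)) := by
  have : (velocity Ω : Set (L2Pair Ω)) = (X Ω : Set (L2Pair Ω)) ∩ ⋂ q ∈ Q Ω,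
      {p : L2Pair Ω | ∫ x in Ω, q x * divergence p x = 0} := by
    ext p
    simp only [Set.mem_inter_iff, Set.mem_iInter, Set.mem_ofPred_eq]
    constructor
    · intro hp
      obtain ⟨v, rfl⟩ := exists_eq_coe_of_mem_velocity hp
      refine ⟨v.1.2, fun q hq => ?_⟩
      simp only [mul_comm (q _)]
      exact v.2 q hq
    · rintro ⟨hX, hp⟩
      refine ⟨⟨p, hX⟩, fun q hq => ?_, rfl⟩
      simp only [mul_comm _ (q _)]
      exact hp q hq
  rw [this]
  refine (isClosed_H1.inter (testFields Ω).isClosed_topologicalClosure).inter ?_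
  exact isClosed_biInter fun q _ =>
    isClosed_eq (continuous_integral_mul_divergence _ (Lp.memLp q)) continuous_const

instance completeSpace_velocity : CompleteSpace (velocity Ω) :=
  isClosed_velocity.completeSpace_coe

end Closed

/-! ### Skew-symmetry of the convective form -/

section Skew

open Filter Topology

variable {d : ℕ} {Ω : Set (Euc d)}

theorem integral_partialDeriv_eq_zero {φ : Euc d → Euc d} (hφ : IsTestFun Ω φ) (i : Fin d) :
    ∫ x in Ω, partialDeriv i φ x = 0 := by
  have hs : HasCompactSupport (partialDeriv i φ) :=
    hφ.2.1.fderiv_apply (𝕜 := ℝ) (EuclideanSpace.single i 1)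
  have hc : Continuous (partialDeriv i φ) :=
    (hφ.1.continuous_fderiv (by simp)).clm_apply continuous_const
  rw [setIntegral_eq_integral_of_forall_compl_eq_zero]
  · have h := integral_smul_fderiv_eq_neg_fderiv_smul_of_integrable
      (μ := (volume : Measure (Euc d))) (f := fun _ : Euc d => (1 : ℝ)) (g := φ)
      (v := EuclideanSpace.single i 1) (by simp)
      (by simpa using! hc.integrable_of_hasCompactSupport hs)
      (by simpa using! hφ.1.continuous.integrable_of_hasCompactSupport hφ.2.1)
      (fun x _ => differentiableAt_const _) (fun x _ => hφ.1.differentiable (by simp) x)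
    simpa using! h
  · intro x hx
    have : x ∉ tsupport φ := fun h => hx (hφ.2.2 h)
    have h0 : fderiv ℝ φ x = 0 := by
      by_contra h
      exact this (support_fderiv_subset ℝ h)
    simp [partialDeriv, h0]

theorem integral_divergence_eq_zero (hΩb : Bornology.IsBounded Ω) {p : L2Pair Ω}
    (hp : p ∈ (testFields Ω).topologicalClosure) : ∫ x in Ω, divergence p x = 0 := by
  have hfin : IsFiniteMeasure ((volume : Measure (Euc d)).restrict Ω) :=
    ⟨by rw [Measure.restrict_apply_univ]; exact hΩb.measure_lt_top⟩
  have h1 : MemLp (fun _ : Euc d => (1 : ℝ)) 2 (volume.restrict Ω) := memLp_const 1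
  have hcl : IsClosed {p : L2Pair Ω | ∫ x in Ω, (1 : ℝ) * divergence p x = 0} :=
    isClosed_eq (continuous_integral_mul_divergence _ h1) continuous_const
  have hsub : (testFields Ω : Set (L2Pair Ω)) ⊆
      {p : L2Pair Ω | ∫ x in Ω, (1 : ℝ) * divergence p x = 0} := by
    rintro q ⟨φ, hφ, -, hq⟩
    rw [Set.mem_ofPred_eq, integral_mul_divergence q _ h1]
    refine Finset.sum_eq_zero fun i _ => ?_
    rw [weightedIntegral_apply]
    simp only [one_smul]
    rw [integral_congr_ae (hq i), integral_partialDeriv_eq_zero hφ]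
    rfl
  have := closure_minimal hsub hcl hp
  simpa using this

/-- The divergence of a field in `V` has mean zero, so it may be tested against itself. -/
theorem divergence_ae_eq_zero (hΩb : Bornology.IsBounded Ω) (v : V Ω) :
    divergence (v : L2Pair Ω) =ᵐ[volume.restrict Ω] 0 := by
  have hmem := memLp_divergence (v : L2Pair Ω)
  have hcoe := hmem.coeFn_toLp
  have hQ : hmem.toLp _ ∈ Q Ω := by
    show ∫ x in Ω, hmem.toLp _ x = 0
    rw [integral_congr_ae hcoe]
    exact integral_divergence_eq_zero hΩb v.1.2.2
  have h0 := v.2 _ hQ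
  have h1 : ∫ x in Ω, divergence (v : L2Pair Ω) x * divergence (v : L2Pair Ω) x = 0 := by
    rw [← h0]
    refine integral_congr_ae ?_
    filter_upwards [hcoe] with x hx
    rw [hx]
  have h2 := (integral_eq_zero_iff_of_nonneg (fun x => mul_self_nonneg _)
    (hmem.integrable_mul hmem)).1 h1
  filter_upwards [h2] with x hx
  exact mul_self_eq_zero.1 hx

/-- For a test field `φ`, `(v · ∇φ, φ) = ∫ v · ∇(|φ|² / 2) = -∫ (∇ · v) |φ|² / 2 = 0`. -/
theorem convection_self_of_mem_testFields (hΩb : Bornology.IsBounded Ω) (v : V Ω) {p : L2Pair Ω}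
    (hp : p ∈ testFields Ω) : convection (v : L2Pair Ω) p p = 0 := by
  obtain ⟨φ, hφ, h1, h2⟩ := hp
  set ψ : Euc d → ℝ := fun x => (1 / 2 : ℝ) * ‖φ x‖ ^ 2 with hψdef
  have hψ : IsTestFun Ω ψ := by
    have hcl : tsupport ψ ⊆ tsupport φ := by
      refine closure_mono fun x hx => ?_
      rw [Function.mem_support] at hx ⊢
      intro h
      exact hx (by simp [hψdef, h])
    refine ⟨contDiff_const.mul (hφ.1.norm_sq ℝ), ?_, hcl.trans hφ.2.2⟩
    exact hφ.2.1.mono' ((subset_tsupport ψ).trans hcl)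
  have hder : ∀ i x, partialDeriv i ψ x = inner ℝ (partialDeriv i φ x) (φ x) := by
    intro i x
    have hd : HasFDerivAt φ (fderiv ℝ φ x) x := (hφ.1.differentiable (by simp) x).hasFDerivAt
    have h := (hd.norm_sq.const_mul (1 / 2 : ℝ)).fderiv
    unfold partialDeriv
    rw [h, real_inner_comm]
    simp
  have hweak : ∀ i, ∫ x in Ω, partialDeriv i ψ x * (v : L2Pair Ω).fst x i =
      - weightedIntegral ψ hψ.memLp ((v : L2Pair Ω).snd i) i := by
    intro i
    have h : weightedIntegral _ (hψ.memLp_partialDeriv i) (v : L2Pair Ω).fst =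
        - weightedIntegral ψ hψ.memLp ((v : L2Pair Ω).snd i) := v.1.2.1 i ψ hψ
    rw [← weightedIntegral_apply_coord _ (hψ.memLp_partialDeriv i), h, PiLp.neg_apply]
  have hcongr : convection (v : L2Pair Ω) p p =
      ∫ x in Ω, ∑ i, partialDeriv i ψ x * (v : L2Pair Ω).fst x i := by
    refine integral_congr_ae ?_
    filter_upwards [h1, ae_all_iff.2 h2] with x hx hx'
    refine Finset.sum_congr rfl fun i _ => ?_
    rw [hx, hx' i, hder, mul_comm]
  rw [hcongr, integral_finsetSum]
  · simp only [hweak]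
    rw [Finset.sum_neg_distrib, ← integral_mul_divergence, neg_eq_zero]
    rw [integral_congr_ae (g := 0), Pi.zero_def, integral_zero]
    filter_upwards [divergence_ae_eq_zero hΩb v] with x hx
    rw [hx, Pi.zero_apply, mul_zero]
  · intro i _
    exact (EuclideanSpace.proj i : Euc d →L[ℝ] ℝ).integrable_comp
      (integrable_smul_L2 (hψ.memLp_partialDeriv i) _)

/-- `(v · ∇w, w) = 0` for `v ∈ V`, by density of the test fields and continuity of the form. -/
theorem convection_self_eq_zero (hd : d = 2 ∨ d = 3) (hΩb : Bornology.IsBounded Ω) (v : V Ω)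
    {p : L2Pair Ω} (hp : p ∈ (testFields Ω).topologicalClosure) :
    convection (v : L2Pair Ω) p p = 0 := by
  obtain ⟨C, hC0, hC⟩ := exists_eLpNorm_four_le hd hΩb
  set W := (testFields Ω).topologicalClosure with hW
  let vW : W := ⟨(v : L2Pair Ω), v.1.2.2⟩
  have hfin : ∀ z : W, eLpNorm (W.subtype z).fst 4 (volume.restrict Ω) ≠ ⊤ := fun z =>
    ne_top_of_le_ne_top ENNReal.ofReal_ne_top (hC z z.2)
  have hsnd : ∀ z : L2Pair Ω, ‖z.snd‖ ≤ ‖z‖ := fun z => WithLp.norm_snd_le _ z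
  let B : W →L[ℝ] W →L[ℝ] ℝ :=
    (convectionForm W.subtype hfin vW).mkContinuous₂ (d * (C * ‖(v : L2Pair Ω).snd‖) * C) <| by
      intro x y
      refine (abs_convection_le (mul_nonneg hC0 (norm_nonneg _)) (mul_nonneg hC0 (norm_nonneg _))
        (hC _ vW.2) (hC _ y.2)).trans ?_
      calc _ = d * (C * ‖(v : L2Pair Ω).snd‖) * C *
            ‖(x : L2Pair Ω).snd‖ * ‖(y : L2Pair Ω).snd‖ := by simp only [vW, Submodule.subtype_apply]; ring
        _ ≤ _ := by
          gcongr
          · exact hsnd x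
          · exact hsnd y
  obtain ⟨s, hs, hlim⟩ := mem_closure_iff_seq_limit.1 hp
  let sW : ℕ → W := fun n => ⟨s n, (testFields Ω).le_topologicalClosure (hs n)⟩
  have hlimW : Tendsto sW atTop (𝓝 ⟨p, hp⟩) := tendsto_subtype_rng.2 hlim
  have hB : Tendsto (fun n => B (sW n) (sW n)) atTop (𝓝 (B ⟨p, hp⟩ ⟨p, hp⟩)) :=
    ((B.continuous.clm_apply continuous_id).tendsto _).comp hlimW
  have h0 : ∀ n, B (sW n) (sW n) = 0 := fun n =>
    convection_self_of_mem_testFields hΩb v (hs n)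
  simp only [h0] at hB
  exact tendsto_nhds_unique hB tendsto_const_nhds

end Skew

/-! ### The Navier–Stokes forms on the velocity spaces -/

section Assembly

variable {d : ℕ} {Ω : Set (Euc d)}

/-- The gradient on `X`, as a linear map. -/
noncomputable def gradX (Ω : Set (Euc d)) : X Ω →ₗ[ℝ] PiLp 2 (fun _ : Fin d => L2Vec Ω) where
  toFun v := (v : L2Pair Ω).snd
  map_add' _ _ := rfl
  map_smul' _ _ := rfl

theorem exists_norm_le_gradX (hd : d = 2 ∨ d = 3) (hΩb : Bornology.IsBounded Ω) :
    ∃ C : ℝ, 0 < C ∧ ∀ v : X Ω, ‖v‖ ≤ C * ‖gradX Ω v‖ := by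
  obtain ⟨C, hC0, hC⟩ := exists_norm_fst_le hd hΩb
  refine ⟨C + 1, by positivity, fun v => ?_⟩
  have h1 : ‖(v : L2Pair Ω).fst‖ ≤ C * ‖gradX Ω v‖ := hC _ v.2.2
  have h2 : ‖v‖ ^ 2 = ‖(v : L2Pair Ω).fst‖ ^ 2 + ‖gradX Ω v‖ ^ 2 :=
    WithLp.prod_norm_sq_eq_of_L2 (v : L2Pair Ω)
  have h3 := norm_nonneg (gradX Ω v)
  refine le_of_sq_le_sq ?_ (by positivity)
  rw [h2]
  nlinarith [mul_nonneg hC0 (sq_nonneg ‖gradX Ω v‖), norm_nonneg (v : L2Pair Ω).fst,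
    mul_self_le_mul_self (norm_nonneg (v : L2Pair Ω).fst) h1]

theorem gradX_injective (hd : d = 2 ∨ d = 3) (hΩb : Bornology.IsBounded Ω) :
    Function.Injective (gradX Ω) := by
  obtain ⟨C, -, hC⟩ := exists_norm_le_gradX hd hΩb
  refine (injective_iff_map_eq_zero _).2 fun v hv => ?_
  have := hC v
  rw [hv, norm_zero, mul_zero] at this
  exact norm_le_zero_iff.1 this

theorem isDualBounded_gradX (hd : d = 2 ∨ d = 3) (hΩb : Bornology.IsBounded Ω)
    (f : X Ω →L[ℝ] ℝ) : IsDualBounded (gradX Ω) (f : X Ω →ₗ[ℝ] ℝ) := by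
  obtain ⟨C, -, hC⟩ := exists_norm_le_gradX hd hΩb
  refine ⟨‖f‖ * C, fun χ => (f.le_opNorm χ).trans ?_⟩
  rw [mul_assoc]
  exact mul_le_mul_of_nonneg_left (hC χ) f.opNorm_nonneg

theorem eLpNorm_four_ne_top (hd : d = 2 ∨ d = 3) (hΩb : Bornology.IsBounded Ω) (v : V Ω) :
    eLpNorm (((X Ω).subtype ∘ₗ (V Ω).subtype) v).fst 4 (volume.restrict Ω) ≠ ⊤ := by
  obtain ⟨C, -, hC⟩ := exists_eLpNorm_four_le hd hΩb
  exact ne_top_of_le_ne_top ENNReal.ofReal_ne_top (hC _ v.1.2.2)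

theorem exists_abs_convection_le (hd : d = 2 ∨ d = 3) (hΩb : Bornology.IsBounded Ω) :
    ∃ C : ℝ, 0 ≤ C ∧ ∀ v w χ : V Ω, |convection (v : L2Pair Ω) w χ| ≤
      C * gradNorm (v : L2Pair Ω) * gradNorm (w : L2Pair Ω) * gradNorm (χ : L2Pair Ω) := by
  obtain ⟨C, hC0, hC⟩ := exists_eLpNorm_four_le hd hΩb
  refine ⟨d * C * C, by positivity, fun v w χ => ?_⟩
  refine (abs_convection_le (mul_nonneg hC0 (norm_nonneg _)) (mul_nonneg hC0 (norm_nonneg _))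
    (hC _ v.1.2.2) (hC _ χ.1.2.2)).trans (le_of_eq ?_)
  unfold gradNorm
  ring

theorem convectionConst_nonneg (Ω : Set (Euc d)) : 0 ≤ convectionConst Ω :=
  Real.sInf_nonneg fun _ h => h.1

/-- The infimum defining `convectionConst` is attained. -/
theorem convection_le_of_convectionConst_le (hd : d = 2 ∨ d = 3) (hΩb : Bornology.IsBounded Ω)
    {M : ℝ} (hM : convectionConst Ω ≤ M) (v w χ : V Ω) : convection (v : L2Pair Ω) w χ ≤
      M * gradNorm (v : L2Pair Ω) * gradNorm (w : L2Pair Ω) * gradNorm (χ : L2Pair Ω) := by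
  obtain ⟨C, hC0, hC⟩ := exists_abs_convection_le hd hΩb
  set P := gradNorm (v : L2Pair Ω) * gradNorm (w : L2Pair Ω) * gradNorm (χ : L2Pair Ω) with hP
  have hP0 : 0 ≤ P := mul_nonneg (mul_nonneg (norm_nonneg _) (norm_nonneg _)) (norm_nonneg _)
  have hassoc : ∀ c : ℝ, c * gradNorm (v : L2Pair Ω) * gradNorm (w : L2Pair Ω) *
      gradNorm (χ : L2Pair Ω) = c * P := fun c => by rw [hP]; ring
  rw [hassoc]
  rcases hP0.eq_or_lt with h0 | h0
  · have := (le_abs_self _).trans (hC v w χ)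
    rw [hassoc, ← h0, mul_zero] at this
    rwa [← h0, mul_zero]
  · rw [← div_le_iff₀ h0]
    refine le_trans ?_ hM
    unfold convectionConst
    refine le_csInf ⟨C, hC0, fun v w χ => (le_abs_self _).trans (hC v w χ)⟩ ?_
    rintro c ⟨-, hc⟩
    rw [div_le_iff₀ h0, ← hassoc]
    exact hc v w χ

/-- The Navier–Stokes data on `V`. -/
noncomputable def flowData (hd : d = 2 ∨ d = 3) (hΩb : Bornology.IsBounded Ω) {ν : ℝ}
    (hν : 0 < ν) (f : X Ω →L[ℝ] ℝ) {M : ℝ} (hM : convectionConst Ω ≤ M) :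
    FlowData (V Ω) (PiLp 2 (fun _ : Fin d => L2Vec Ω)) where
  D := gradX Ω ∘ₗ (V Ω).subtype
  b := convectionForm ((X Ω).subtype ∘ₗ (V Ω).subtype) (eLpNorm_four_ne_top hd hΩb)
  F := (f : X Ω →ₗ[ℝ] ℝ) ∘ₗ (V Ω).subtype
  ν := ν
  M := M
  K := normX' f
  injective := (gradX_injective hd hΩb).comp Subtype.val_injective
  ν_pos := hν
  M_nonneg := (convectionConst_nonneg Ω).trans hM
  K_nonneg := dualNorm_nonneg (gradX_injective hd hΩb) (isDualBounded_gradX hd hΩb f)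
  skew u v := convection_self_eq_zero hd hΩb u v.1.2.2
  b_le := convection_le_of_convectionConst_le hd hΩb hM
  F_le v := le_dualNorm_mul (gradX_injective hd hΩb) (isDualBounded_gradX hd hΩb f) v

/-- The Lax–Milgram theorem for a bilinear form that is not bundled with its continuity. -/
theorem exists_forall_eq_of_coercive {E : Type*} [NormedAddCommGroup E] [InnerProductSpace ℝ E]
    [CompleteSpace E] (L : E →ₗ[ℝ] E →ₗ[ℝ] ℝ) {C c K : ℝ}
    (hL : ∀ w v, |L w v| ≤ C * ‖w‖ * ‖v‖) (hc : 0 < c) (hco : ∀ v, c * ‖v‖ * ‖v‖ ≤ L v v)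
    (F : E →ₗ[ℝ] ℝ) (hF : ∀ v, |F v| ≤ K * ‖v‖) : ∃ w, ∀ v, L w v = F v := by
  have hcoer : IsCoercive (L.mkContinuous₂ C hL) := ⟨c, hc, hco⟩
  refine ⟨hcoer.continuousLinearEquivOfBilin.symm
    ((InnerProductSpace.toDual ℝ E).symm (F.mkContinuous K hF)), fun v => ?_⟩
  have h := hcoer.continuousLinearEquivOfBilin_apply (hcoer.continuousLinearEquivOfBilin.symm
    ((InnerProductSpace.toDual ℝ E).symm (F.mkContinuous K hF))) v
  rw [ContinuousLinearEquiv.apply_symm_apply, InnerProductSpace.toDual_symm_apply] at h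
  exact h.symm

/-- The gradient on `velocity Ω`, as a linear map. -/
noncomputable def gradVelocity (Ω : Set (Euc d)) :
    velocity Ω →ₗ[ℝ] PiLp 2 (fun _ : Fin d => L2Vec Ω) where
  toFun v := (v : L2Pair Ω).snd
  map_add' _ _ := rfl
  map_smul' _ _ := rfl

/-- Solvability of the Picard linearization: the form `ν(∇w, ∇v) + (u · ∇w, v)` is coercive by
skew-symmetry and the Poincaré inequality, so the Lax–Milgram theorem applies. -/
theorem exists_isPicardSol (hd : d = 2 ∨ d = 3) (hΩb : Bornology.IsBounded Ω) {ν : ℝ}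
    (hν : 0 < ν) (f : X Ω →L[ℝ] ℝ) (u : V Ω) : ∃ w, IsPicardSol ν f u w := by
  obtain ⟨C, hC0, hC⟩ := exists_eLpNorm_four_le hd hΩb
  obtain ⟨c, hc0, hc⟩ := exists_norm_le_gradX hd hΩb
  have hmem : ∀ v : velocity Ω, (v : L2Pair Ω) ∈ (testFields Ω).topologicalClosure :=
    fun v => (velocity_le_X v.2).2
  have hfin : ∀ v : velocity Ω, eLpNorm ((velocity Ω).subtype v).fst 4 (volume.restrict Ω) ≠ ⊤ :=
    fun v => ne_top_of_le_ne_top ENNReal.ofReal_ne_top (hC _ (hmem v))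
  have hDle : ∀ v, ‖gradVelocity Ω v‖ ≤ ‖v‖ := fun v => WithLp.norm_snd_le _ (v : L2Pair Ω)
  have h1 : ∀ w v : velocity Ω, |ν * inner ℝ (gradVelocity Ω w) (gradVelocity Ω v)| ≤
      ν * (‖w‖ * ‖v‖) := fun w v => by
    rw [abs_mul, abs_of_pos hν]
    exact mul_le_mul_of_nonneg_left ((abs_real_inner_le_norm _ _).trans
      (mul_le_mul (hDle w) (hDle v) (norm_nonneg _) (norm_nonneg _))) hν.le
  have h2 : ∀ w v : velocity Ω, |convection (u : L2Pair Ω) w v| ≤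
      d * C * C * ‖(u : L2Pair Ω).snd‖ * (‖w‖ * ‖v‖) := fun w v => by
    have h3 := abs_convection_le (v := (w : L2Pair Ω))
      (mul_nonneg hC0 (norm_nonneg (u : L2Pair Ω).snd))
      (mul_nonneg hC0 (norm_nonneg (v : L2Pair Ω).snd)) (hC _ u.1.2.2) (hC _ (hmem v))
    calc _ ≤ _ := h3
      _ = d * C * C * ‖(u : L2Pair Ω).snd‖ *
          (‖(w : L2Pair Ω).snd‖ * ‖(v : L2Pair Ω).snd‖) := by ring
      _ ≤ _ := mul_le_mul_of_nonneg_left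
          (mul_le_mul (hDle w) (hDle v) (norm_nonneg _) (norm_nonneg _)) (by positivity)
  obtain ⟨w, hw⟩ := exists_forall_eq_of_coercive
    (ν • (innerₗ (PiLp 2 (fun _ : Fin d => L2Vec Ω))).compl₁₂ (gradVelocity Ω) (gradVelocity Ω) +
      convectionForm (velocity Ω).subtype hfin ⟨u, coe_mem_velocity u⟩)
    (C := ν + d * C * C * ‖(u : L2Pair Ω).snd‖) (c := ν / c ^ 2) (K := ‖f‖)
    (fun w v => (abs_add_le _ _).trans ((add_le_add (h1 w v) (h2 w v)).trans
      (le_of_eq (by ring)))) (by positivity)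
    (fun v => by
      have hskew := convection_self_eq_zero hd hΩb u (hmem v)
      have h3 : ‖v‖ ≤ c * ‖gradVelocity Ω v‖ := hc ⟨v, velocity_le_X v.2⟩
      have h4 : ν / c ^ 2 * ‖v‖ * ‖v‖ ≤
          ν * inner ℝ (gradVelocity Ω v) (gradVelocity Ω v) + convection (u : L2Pair Ω) v v := by
        rw [hskew, add_zero, real_inner_self_eq_norm_sq, mul_assoc, div_mul_eq_mul_div,
          div_le_iff₀ (by positivity)]
        calc ν * (‖v‖ * ‖v‖) ≤ ν * ((c * ‖gradVelocity Ω v‖) * (c * ‖gradVelocity Ω v‖)) :=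
              mul_le_mul_of_nonneg_left
                (mul_le_mul h3 h3 (norm_nonneg _) ((norm_nonneg _).trans h3)) hν.le
          _ = _ := by ring
      exact h4)
    ((f : X Ω →ₗ[ℝ] ℝ) ∘ₗ Submodule.inclusion velocity_le_X)
    (fun v => f.le_opNorm ⟨v, velocity_le_X v.2⟩)
  obtain ⟨w', hw'⟩ := exists_eq_coe_of_mem_velocity w.2
  refine ⟨w', fun v => ?_⟩
  rw [hw']
  exact hw ⟨v, coe_mem_velocity v⟩

theorem isPicardSol_picard (hd : d = 2 ∨ d = 3) (hΩb : Bornology.IsBounded Ω) {ν : ℝ}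
    (hν : 0 < ν) (f : X Ω →L[ℝ] ℝ) (u : V Ω) : IsPicardSol ν f u (picard ν f u) :=
  Classical.epsilon_spec (exists_isPicardSol hd hΩb hν f u)

/-- The one-step residual estimate, with `n = min k m` the number of earlier iterates used. -/
theorem normV'_residual_step_le (hd : d = 2 ∨ d = 3) (hΩb : Bornology.IsBounded Ω) {ν : ℝ}
    (hν : 0 < ν) (f : X Ω →L[ℝ] ℝ) {M : ℝ} (hM : convectionConst Ω ≤ M)
    (hκ : kappa M ν f < 1) {m : ℕ} {u : ℕ → V Ω} {k n : ℕ} {a : ℕ → ℝ}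
    (hn : min k m = n) (hn1 : 1 ≤ n) (hstep : IsAAgStep ν f m u k a) {A : ℝ}
    (hA : ∀ i ≤ n, |a i| ≤ A) :
    normV' (residual ν f (u (k + 1))) ≤
      min (theta ν f m u k a * kappa M ν f) (gamma ν f m u k a) * normV' (residual ν f (u k)) +
        4 * M * ((n : ℝ) + 1) * (n : ℝ) ^ 3 * A ^ 2 *
          (kappa M ν f ^ 2 / (ν ^ 2 * (1 - kappa M ν f) ^ 2)) *
          ∑ i ∈ Finset.range (n + 1), normV' (residual ν f (u (k - i))) ^ 2 := by
  obtain ⟨hsum, hopt, hupd⟩ := hstep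
  unfold theta gamma
  rw [hn] at hsum hopt hupd ⊢
  set S := flowData hd hΩb hν f hM with hS
  have hsol : ∀ v, S.IsSol v (picard ν f v) := isPicardSol_picard hd hΩb hν f
  have hres : ∀ v, (S.res v : V Ω → ℝ) = residual ν f v := fun v => funext (S.res_apply v)
  have hnorm : ∀ v, normV' (residual ν f v) = S.dnorm (S.res v) := fun v => by
    rw [← hres]; rfl
  have hcomb : combinedResidual ν f u k n a =
      ⇑(∑ i ∈ Finset.range (n + 1), a i • S.res (picard ν f (u (k - i)))) := by
    funext χ
    simp only [combinedResidual, ← hres, Finset.sum_apply, Pi.smul_apply, LinearMap.sum_apply,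
      LinearMap.smul_apply]
  have hmain := S.dnorm_res_sum_le hn1 a
    (fun i hi => hA i (Nat.lt_succ_iff.1 (Finset.mem_range.1 hi))) hsum
    (fun i => u (k - i)) (fun i => picard ν f (u (k - i))) (fun i => hsol _) hκ
  have hc0 : 0 ≤ normV' (combinedResidual ν f u k n a) := by
    rw [hcomb]
    exact dualNorm_nonneg S.injective
      (IsDualBounded.sum_smul _ _ fun i => S.isDualBounded_res _)
  -- Minimality, compared with the weights of the plain Picard step.
  have hpicard : normV' (combinedResidual ν f u k n a) ≤
      normV' (residual ν f (picard ν f (u k))) := by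
    have h1 := hopt (fun i => if i = 0 then 1 else 0) (by simp)
    have h2 : combinedResidual ν f u k n (fun i => if i = 0 then 1 else 0) =
        residual ν f (picard ν f (u k)) := by
      simp [combinedResidual, ite_smul]
    rw [h2] at h1
    refine le_of_sq_le_sq h1 ?_
    rw [hnorm]
    exact S.dnorm_res_nonneg _
  have hcontr : normV' (residual ν f (picard ν f (u k))) ≤
      kappa M ν f * normV' (residual ν f (u k)) := by
    rw [hnorm, hnorm]
    exact (hsol (u k)).dnorm_res_le
  have hfirst : normV' (combinedResidual ν f u k n a) ≤
      min (normV' (combinedResidual ν f u k n a) /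
        normV' (residual ν f (picard ν f (u k))) * kappa M ν f)
        (normV' (combinedResidual ν f u k n a) / normV' (residual ν f (u k))) *
        normV' (residual ν f (u k)) := by
    have hG : 0 ≤ normV' (residual ν f (u k)) := by rw [hnorm]; exact S.dnorm_res_nonneg _
    rw [min_mul_of_nonneg _ _ hG]
    refine le_min ?_ ?_
    -- A vanishing denominator forces the numerator to vanish, by `hpicard` and `hcontr`.
    · rcases eq_or_ne (normV' (residual ν f (picard ν f (u k)))) 0 with h0 | h0
      · rw [h0, div_zero, zero_mul, zero_mul, ← h0]
        exact hpicard
      · rw [mul_assoc]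
        calc _ = normV' (combinedResidual ν f u k n a) /
              normV' (residual ν f (picard ν f (u k))) *
              normV' (residual ν f (picard ν f (u k))) := (div_mul_cancel₀ _ h0).symm
          _ ≤ _ := mul_le_mul_of_nonneg_left hcontr
              (div_nonneg hc0 (hc0.trans hpicard))
    · rcases eq_or_ne (normV' (residual ν f (u k))) 0 with h0 | h0
      · rw [h0, mul_zero] at hcontr ⊢
        exact hpicard.trans hcontr
      · rw [div_mul_cancel₀ _ h0]
  have hcd : normV' (combinedResidual ν f u k n a) =
      S.dnorm (∑ i ∈ Finset.range (n + 1), a i • S.res (picard ν f (u (k - i)))) := by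
    rw [hcomb]; rfl
  rw [hcd] at hfirst
  rw [hcd, hupd]
  simp only [hnorm] at hfirst ⊢
  exact hmain.trans (add_le_add hfirst le_rfl)

end Assembly

end NSE

theorem mainTheorem2 {d : ℕ} (hd : d = 2 ∨ d = 3) (Ω : Set (NSE.Euc d))
    (hΩo : IsOpen Ω) (hΩc : IsConnected Ω) (hΩb : Bornology.IsBounded Ω)
    (ν : ℝ) (hν : 0 < ν) (f : NSE.X Ω →L[ℝ] ℝ)
    (M : ℝ) (hM : NSE.convectionConst Ω ≤ M) (hκ : NSE.kappa M ν f < 1)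
    (m : ℕ) (hm : 1 < m) (u : ℕ → NSE.V Ω) (α : ℕ → ℕ → ℝ) (k : ℕ)
    (hstep : ∀ j ≤ k, NSE.IsAAgStep ν f m u j (α j))
    (αbar : ℝ) (hα : ∀ i ≤ min k m, |α k i| ≤ αbar) :
    (m < k →
      NSE.normV' (NSE.residual ν f (u (k + 1))) ≤
        min (NSE.theta ν f m u k (α k) * NSE.kappa M ν f) (NSE.gamma ν f m u k (α k)) *
            NSE.normV' (NSE.residual ν f (u k)) +
          4 * M * ((m : ℝ) + 1) * (m : ℝ) ^ 3 * αbar ^ 2 *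
            (NSE.kappa M ν f ^ 2 / (ν ^ 2 * (1 - NSE.kappa M ν f) ^ 2)) *
            ∑ i ∈ Finset.range (m + 1), NSE.normV' (NSE.residual ν f (u (k - i))) ^ 2) ∧
    (1 < k → k ≤ m →
      NSE.normV' (NSE.residual ν f (u (k + 1))) ≤
        min (NSE.theta ν f m u k (α k) * NSE.kappa M ν f) (NSE.gamma ν f m u k (α k)) *
            NSE.normV' (NSE.residual ν f (u k)) +
          4 * M * (((min m k : ℕ) : ℝ) + 1) * ((min m k : ℕ) : ℝ) ^ 3 * αbar ^ 2 *
            (NSE.kappa M ν f ^ 2 / (ν ^ 2 * (1 - NSE.kappa M ν f) ^ 2)) *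
            ∑ i ∈ Finset.range (min m k + 1),
              NSE.normV' (NSE.residual ν f (u (k - i))) ^ 2) := by
  refine ⟨fun hmk => ?_, fun hk hkm => ?_⟩
  · have h : min k m = m := min_eq_right hmk.le
    rw [h] at hα
    exact NSE.normV'_residual_step_le hd hΩb hν f hM hκ h hm.le (hstep k le_rfl) hα
  · rw [min_comm m k]
    exact NSE.normV'_residual_step_le hd hΩb hν f hM hκ rfl (le_min hk.le hm.le)
      (hstep k le_rfl) hα
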